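/- \textbf{Setting.} Consider a half-duplex discrete memoryless network with two terminals $a,b$ and relays $\mathcal R=\{r_1,\dots,r_m\}$. Each node $i$ has a finite nonempty input alphabet $\mathcal X_i$ and a finite output alphabet $\mathcal Y_i$, both extended by a dummy symbol $\varnothing$ (no input / no output); in each channel use every node has input $\varnothing$ or output $\varnothing$. In the $(m,2)$ MABC protocol a block of $n$ channel uses is split into a first phase of $n_1$ uses, in which exactly $a$ and $b$ transmit (their inputs lie in $\mathcal X_a,\mathcal X_b$, all other inputs are $\varnothing$), followed by a second phase of $n_2=n-n_1$ uses, in which exactly the relays transmit. The messages $W_a$ (from $a$ to $b$) and $W_b$ (from $b$ to $a$) are independent and uniform on sets of sizes $\lfloor 2^{nR_a}\rfloor$ and $\lfloor 2^{nR_b}\rfloor$, with $R_a,R_b\ge 0$. At each time the input of a node is a function of its own message (relays have none) and of its past outputs; each terminal decodes the other's message from its own message and all its outputs. Fix $\Delta_1,\Delta_2\ge 0$ with $\Delta_1+\Delta_2=1$. A pair $(R_a,R_b)$ is achievable if there are codes of all block lengths $n$ for which both error probabilities tend to $0$ and $n_\ell/n\to\Delta_\ell$ for $\ell=1,2$. The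 capacity region is the closure of the set of achievable pairs. \textbf{Theorem ($(m,2)$ MABC outer bound).} For every $(R_a,R_b)$ in the capacity region there are a time-sharing variable $Q$ with $|\mathcal Q|\le 2^{m+1}$ and a choice of distributions $p^{(1)}(q)$, $p^{(1)}(x_a|q)$, $p^{(1)}(x_b|q)$ on $\mathcal X_a$, $\mathcal X_b$ and $p^{(2)}(x_{\mathcal R})$ on $\prod_{r\in\mathcal R}\mathcal X_r$ such that, for all $S_R\subseteq\mathcal R$ simultaneously, with $\bar S_R=\mathcal R\setminus S_R$, \begin{align*} R_a&\le \Delta_1 I(X_a^{(1)};Y_{\bar S_R}^{(1)}\mid X_b^{(1)},Q)+\Delta_2 I(X_{S_R}^{(2)};Y_b^{(2)}\mid X_{\bar S_R}^{(2)}),\\ R_b&\le \Delta_1 I(X_b^{(1)};Y_{\bar S_R}^{(1)}\mid X_a^{(1)},Q)+\Delta_2 I(X_{S_R}^{(2)};Y_a^{(2)}\mid X_{\bar S_R}^{(2)}). \end{align*} Here the information quantities (in bits) are computed under the joint distributions $p^{(1)}(q)\,p^{(1)}(x_a|q)\,p^{(1)}(x_b|q)\,p^{(1)}(y_{\mathcal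 R}|x_a,x_b)$ in phase 1 and $p^{(2)}(x_{\mathcal R})\,p^{(2)}(y_a,y_b|x_{\mathcal R})$ in phase 2, where $p^{(1)}(y_{\mathcal R}|x_a,x_b)$ and $p^{(2)}(y_a,y_b|x_{\mathcal R})$ are the channel laws when exactly the terminals, respectively exactly the relays, transmit. -/

import Mathlib

open Filter Topology

namespace MABC

universe u v w

/-! ## Information measures of finite distributions, in bits -/

/-- The law of the random variable `f` on a finite space `Ω` with mass function `p`. -/
noncomputable def marginal {Ω : Type u} {α : Type v} [Fintype Ω] (p : Ω → ℝ) (f : Ω → α) :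
    α → ℝ :=
  open Classical in fun a => ∑ ω, if f ω = a then p ω else 0

/-- Shannon entropy `H(f)`, in bits. -/
noncomputable def entropy {Ω : Type u} {α : Type v} [Fintype Ω] [Fintype α]
    (p : Ω → ℝ) (f : Ω → α) : ℝ :=
  ∑ a, -(marginal p f a * Real.logb 2 (marginal p f a))

/-- Conditional entropy `H(f | g) = H(f, g) - H(g)`. -/
noncomputable def condEntropy {Ω : Type u} {α : Type v} {β : Type w} [Fintype Ω] [Fintype α]
    [Fintype β] (p : Ω → ℝ) (f : Ω → α) (g : Ω → β) : ℝ :=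
  entropy p (fun ω => (f ω, g ω)) - entropy p g

/-- Conditional mutual information `I(f ; g | h) = H(f | h) - H(f | g, h)`. -/
noncomputable def condMutualInfo {Ω : Type*} {α : Type*} {β : Type*} {γ : Type*} [Fintype Ω]
    [Fintype α] [Fintype β] [Fintype γ] (p : Ω → ℝ) (f : Ω → α) (g : Ω → β) (h : Ω → γ) : ℝ :=
  condEntropy p f h - condEntropy p f (fun ω => (g ω, h ω))

/-! ## The network -/

/-- The nodes: two terminals `a`, `b` and `m` relays. -/
inductive Node (m : ℕ) : Type
  | a : Node m
  | b : Node m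
  | relay (j : Fin m) : Node m
  deriving DecidableEq, Fintype

/-- A half-duplex discrete memoryless network. Node `i` has input alphabet `X i` and output
alphabet `Y i`, both extended by a dummy symbol `none` that stands for "no input" / "no output".
`law x y` is the probability that one channel use with inputs `x` produces the outputs `y`;
no node sends and receives in the same channel use. -/
structure HalfDuplexNetwork {m : ℕ} (X : Node m → Type u) (Y : Node m → Type v)
    [∀ i, Fintype (Y i)] where
  law : (∀ i, Option (X i)) → (∀ i, Option (Y i)) → ℝ
  law_mem : ∀ x, law x ∈ stdSimplex ℝ (∀ i, Option (Y i))
  half_duplex : ∀ x y, law x y ≠ 0 → ∀ i, x i = none ∨ y i = none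

/-- The two phases of the MABC protocol. -/
inductive Phase : Type
  | one : Phase
  | two : Phase

/-- `Transmits ℓ i`: the MABC protocol lets node `i` transmit in phase `ℓ`. The two terminals
transmit in phase one, all relays transmit in phase two. -/
def Transmits {m : ℕ} : Phase → Node m → Prop
  | .one, .a => True
  | .one, .b => True
  | .one, .relay _ => False
  | .two, .a => False
  | .two, .b => False
  | .two, .relay _ => True

/-! ## Codes -/

/-- What node `i` knows in advance: `a` and `b` know their own messages, from sets of sizes
`Ma` and `Mb`; a relay knows nothing. -/
abbrev Message {m : ℕ} (Ma Mb : ℕ) : Node m → Type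
  | .a => Fin Ma
  | .b => Fin Mb
  | .relay _ => Unit

/-- The knowledge of every node when the messages are `wa` and `wb`. -/
def messages {m : ℕ} {Ma Mb : ℕ} (wa : Fin Ma) (wb : Fin Mb) :
    ∀ i : Node m, Message Ma Mb i
  | .a => wa
  | .b => wb
  | .relay _ => ()

/-- The phase of channel use `k` if phase one consists of the first `n₁` channel uses. -/
def phaseAt (n₁ k : ℕ) : Phase := if k < n₁ then .one else .two

/-- A code of block length `n` for the MABC protocol, with `n₁` channel uses in phase one and
`n - n₁` in phase two. The input of node `i` at time `k` is a function of its message and of the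
outputs it received before time `k`; it is a genuine symbol of `X i` when the protocol lets `i`
transmit at time `k` and the dummy symbol otherwise. Each terminal decodes the message of the
other one from its own message and all its outputs; `none` is a declared error. -/
structure Code {m : ℕ} (X : Node m → Type u) (Y : Node m → Type v) (n Ma Mb : ℕ) where
  n₁ : ℕ
  n₁_le : n₁ ≤ n
  enc : ∀ (i : Node m) (k : Fin n), Message Ma Mb i → (Fin (k : ℕ) → Option (Y i)) →
    Option (X i)
  enc_protocol : ∀ i k w past, enc i k w past ≠ none ↔ Transmits (phaseAt n₁ k) i
  decA : Fin Ma → (Fin n → Option (Y Node.a)) → Option (Fin Mb)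
  decB : Fin Mb → (Fin n → Option (Y Node.b)) → Option (Fin Ma)

namespace Code

/-- The channel inputs of all nodes at time `k`, given the messages and the outputs `y`
(`y j i` is the output at node `i` at time `j`); only outputs before time `k` are used. -/
def input {m : ℕ} {X : Node m → Type u} {Y : Node m → Type v} {n Ma Mb : ℕ}
    (c : Code X Y n Ma Mb) (wa : Fin Ma) (wb : Fin Mb) (y : Fin n → ∀ i, Option (Y i))
    (k : Fin n) : ∀ i, Option (X i) :=
  fun i => c.enc i k (messages wa wb i) (fun j => y ⟨j, j.isLt.trans k.isLt⟩ i)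

/-- The conditional probability of the outputs `y` given the messages. -/
noncomputable def prob {m : ℕ} {X : Node m → Type u} {Y : Node m → Type v}
    [∀ i, Fintype (Y i)] {n Ma Mb : ℕ} (c : Code X Y n Ma Mb) (N : HalfDuplexNetwork X Y)
    (wa : Fin Ma) (wb : Fin Mb) (y : Fin n → ∀ i, Option (Y i)) : ℝ :=
  ∏ k, N.law (c.input wa wb y k) (y k)

/-- The probability that `b` does not recover the message of `a`, for independent uniformly
distributed messages. -/
noncomputable def errorAB {m : ℕ} {X : Node m → Type u} {Y : Node m → Type v}
    [∀ i, Fintype (Y i)] {n Ma Mb : ℕ} (c : Code X Y n Ma Mb) (N : HalfDuplexNetwork X Y) : ℝ :=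
  (∑ wa : Fin Ma, ∑ wb : Fin Mb, ∑ y : Fin n → ∀ i, Option (Y i),
    if c.decB wb (fun k => y k Node.b) = some wa then 0 else c.prob N wa wb y) / (Ma * Mb)

/-- The probability that `a` does not recover the message of `b`, for independent uniformly
distributed messages. -/
noncomputable def errorBA {m : ℕ} {X : Node m → Type u} {Y : Node m → Type v}
    [∀ i, Fintype (Y i)] {n Ma Mb : ℕ} (c : Code X Y n Ma Mb) (N : HalfDuplexNetwork X Y) : ℝ :=
  (∑ wa : Fin Ma, ∑ wb : Fin Mb, ∑ y : Fin n → ∀ i, Option (Y i),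
    if c.decA wa (fun k => y k Node.a) = some wb then 0 else c.prob N wa wb y) / (Ma * Mb)

end Code

/-- The number `⌊2 ^ (n R)⌋` of messages of a code of block length `n` and rate `R`. -/
noncomputable def numMessages (n : ℕ) (R : ℝ) : ℕ := ⌊(2 : ℝ) ^ ((n : ℝ) * R)⌋₊

/-- The rate pair `R = (R_a, R_b)` is achievable for the MABC protocol with relative phase
durations `Δ₁`, `Δ₂`. -/
def Achievable {m : ℕ} {X : Node m → Type u} {Y : Node m → Type v} [∀ i, Fintype (Y i)]
    (N : HalfDuplexNetwork X Y) (Δ₁ Δ₂ : ℝ) (R : ℝ × ℝ) : Prop :=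
  0 ≤ R.1 ∧ 0 ≤ R.2 ∧
  ∃ c : ∀ n : ℕ, Code X Y n (numMessages n R.1) (numMessages n R.2),
    Tendsto (fun n => (c n).errorAB N) atTop (𝓝 0) ∧
    Tendsto (fun n => (c n).errorBA N) atTop (𝓝 0) ∧
    Tendsto (fun n : ℕ => ((c n).n₁ : ℝ) / n) atTop (𝓝 Δ₁) ∧
    Tendsto (fun n : ℕ => ((n : ℝ) - (c n).n₁) / n) atTop (𝓝 Δ₂)

/-- The capacity region of the MABC protocol for fixed phase durations. -/
def capacityRegion {m : ℕ} {X : Node m → Type u} {Y : Node m → Type v} [∀ i, Fintype (Y i)]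
    (N : HalfDuplexNetwork X Y) (Δ₁ Δ₂ : ℝ) : Set (ℝ × ℝ) :=
  closure {R | Achievable N Δ₁ Δ₂ R}

/-! ## The outer bound -/

/-- Inputs in phase one: the terminals send `xa` and `xb`, the relays are silent. -/
def inputOne {m : ℕ} {X : Node m → Type u} (xa : X Node.a) (xb : X Node.b) :
    ∀ i, Option (X i)
  | .a => some xa
  | .b => some xb
  | .relay _ => none

/-- Inputs in phase two: the relays send `x`, the terminals are silent. -/
def inputTwo {m : ℕ} {X : Node m → Type u} (x : ∀ j : Fin m, X (Node.relay j)) :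
    ∀ i, Option (X i)
  | .a => none
  | .b => none
  | .relay j => some (x j)

/-- The sample space of phase one: `(q, x_a, x_b, y)`. -/
abbrev SpaceOne {m : ℕ} (X : Node m → Type u) (Y : Node m → Type v) (K : ℕ) : Type (max u v) :=
  Fin K × X Node.a × X Node.b × (∀ i, Option (Y i))

/-- The sample space of phase two: `(x_R, y)`. -/
abbrev SpaceTwo {m : ℕ} (X : Node m → Type u) (Y : Node m → Type v) : Type (max u v) :=
  (∀ j : Fin m, X (Node.relay j)) × (∀ i, Option (Y i))

/-- The joint distribution `p(q) p(x_a|q) p(x_b|q) p(y|x_a,x_b)` of phase one. -/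
def jointOne {m : ℕ} {X : Node m → Type u} {Y : Node m → Type v} [∀ i, Fintype (Y i)]
    (N : HalfDuplexNetwork X Y) {K : ℕ} (pQ : Fin K → ℝ) (pA : Fin K → X Node.a → ℝ)
    (pB : Fin K → X Node.b → ℝ) : SpaceOne X Y K → ℝ :=
  fun ω => pQ ω.1 * pA ω.1 ω.2.1 * pB ω.1 ω.2.2.1 * N.law (inputOne ω.2.1 ω.2.2.1) ω.2.2.2

/-- The joint distribution `p(x_R) p(y|x_R)` of phase two. -/
def jointTwo {m : ℕ} {X : Node m → Type u} {Y : Node m → Type v} [∀ i, Fintype (Y i)]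
    (N : HalfDuplexNetwork X Y) (pR : (∀ j : Fin m, X (Node.relay j)) → ℝ) :
    SpaceTwo X Y → ℝ :=
  fun ω => pR ω.1 * N.law (inputTwo ω.1) ω.2

/-- `I(X_a ; Y_T | X_b, Q)` in phase one, for a set `T` of relays. -/
noncomputable def infoOneA {m : ℕ} {X : Node m → Type u} {Y : Node m → Type v}
    [∀ i, Fintype (X i)] [∀ i, Fintype (Y i)] {K : ℕ} (p : SpaceOne X Y K → ℝ)
    (T : Finset (Fin m)) : ℝ :=
  condMutualInfo p (fun ω => ω.2.1) (fun ω (j : T) => ω.2.2.2 (Node.relay j))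
    (fun ω => (ω.2.2.1, ω.1))

/-- `I(X_b ; Y_T | X_a, Q)` in phase one, for a set `T` of relays. -/
noncomputable def infoOneB {m : ℕ} {X : Node m → Type u} {Y : Node m → Type v}
    [∀ i, Fintype (X i)] [∀ i, Fintype (Y i)] {K : ℕ} (p : SpaceOne X Y K → ℝ)
    (T : Finset (Fin m)) : ℝ :=
  condMutualInfo p (fun ω => ω.2.2.1) (fun ω (j : T) => ω.2.2.2 (Node.relay j))
    (fun ω => (ω.2.1, ω.1))

/-- `I(X_S ; Y_t | X_{R \ S})` in phase two, for a set `S` of relays and a node `t`. -/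
noncomputable def infoTwo {m : ℕ} {X : Node m → Type u} {Y : Node m → Type v}
    [∀ i, Fintype (X i)] [∀ i, Fintype (Y i)] (p : SpaceTwo X Y → ℝ)
    (S : Finset (Fin m)) (t : Node m) : ℝ :=
  condMutualInfo p (fun ω (j : S) => ω.1 j) (fun ω => ω.2 t)
    (fun ω (j : (Sᶜ : Finset (Fin m))) => ω.1 j)

/-- The set of nonnegative rate pairs for which there are a time-sharing variable `Q` with at most
`2 ^ (m + 1)` values, distributions `p(q)`, `p(x_a|q)`, `p(x_b|q)` for phase one and `p(x_R)` for
phase two, such that both rate constraints hold for every set `S` of relays. -/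
def outerBound {m : ℕ} {X : Node m → Type u} {Y : Node m → Type v} [∀ i, Fintype (X i)]
    [∀ i, Fintype (Y i)] (N : HalfDuplexNetwork X Y) (Δ₁ Δ₂ : ℝ) : Set (ℝ × ℝ) :=
  {R | 0 ≤ R.1 ∧ 0 ≤ R.2 ∧
    ∃ K : ℕ, K ≤ 2 ^ (m + 1) ∧
    ∃ (pQ : Fin K → ℝ) (pA : Fin K → X Node.a → ℝ) (pB : Fin K → X Node.b → ℝ)
      (pR : (∀ j : Fin m, X (Node.relay j)) → ℝ),
      pQ ∈ stdSimplex ℝ (Fin K) ∧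
      (∀ q, pA q ∈ stdSimplex ℝ (X Node.a)) ∧
      (∀ q, pB q ∈ stdSimplex ℝ (X Node.b)) ∧
      pR ∈ stdSimplex ℝ (∀ j : Fin m, X (Node.relay j)) ∧
      ∀ S : Finset (Fin m),
        R.1 ≤ Δ₁ * infoOneA (jointOne N pQ pA pB) Sᶜ
            + Δ₂ * infoTwo (jointTwo N pR) S Node.b ∧
        R.2 ≤ Δ₁ * infoOneB (jointOne N pQ pA pB) Sᶜ
            + Δ₂ * infoTwo (jointTwo N pR) S Node.a}

end MABC

set_option linter.unusedSectionVars false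

/-! This is a cut-set converse, proved by a change of measure in place of Fano's inequality and
entropy chain rules. Fix a receiving terminal and a set of relays on its side of the cut. Given the
messages, the outputs of a code have as law a product of kernels that look only at the past
(`causalProd`). Multiply each kernel by the likelihood ratio (`ratio`) of the observation on the
receiving side, given only the inputs of that side versus given all inputs, computed under some
reference input law. The tilted observation is dominated by a law that does not involve the sender's
message, so a decoder can be right for only a fraction 1/M of the messages. The inequality `log t ≤
t - 1` turns this into a bound on (1 - error) log M by a sum of expected log ratios
(`logb_card_le`), and each expectation depends on the code only through the input law at that time
(`logb_card_le_sum_inputLaw`).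

The reference laws are free as long as they charge all inputs in use. In phase one each time uses
its own input law, which gives one mutual information per channel use, with the time index as
time-sharing variable. In phase two all times share the sum of the input laws of the phase; the
terms then add up exactly to the information of the pooled law, so neither concavity nor time
sharing is needed (`logb_card_le_sum_add`).

Half-duplex operation shapes the laws. The terminals hear nothing during phase one, so their inputs
depend on their own independent messages only and have a product law (`Code.inputLaw_phaseOne`); it
also reduces the cut to the variables of the theorem (`channelInfo_cut_b`, `channelInfo_cut_two`).
The laws come from the code and not from the cut, so all constraints hold simultaneously.
Carathéodory's theorem reduces the time-sharing alphabet (`exists_timeSharing`), and compactness of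
the set of distributions lets the bounds pass to the limit (`isClosed_boundSet`). -/

namespace MABC

/-- The entries of a sequence before time `k`. -/
def past {A : Type*} {n : ℕ} (y : Fin n → A) (k : Fin n) : Fin (k : ℕ) → A :=
  fun j => y ⟨j, j.isLt.trans k.isLt⟩

/-- The product of kernels `κ k` that depend on the entries before time `k`. -/
noncomputable def causalProd {A : Type*} {n : ℕ} (κ : (k : Fin n) → (Fin (k : ℕ) → A) → A → ℝ)
    (y : Fin n → A) : ℝ :=
  ∏ k, κ k (past y k) (y k)

/-! ### Products of causal kernels and the change-of-measure converse -/

section Causal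

variable {A B : Type*} {n : ℕ}

lemma past_snoc_castSucc (y : Fin n → A) (a : A) (k : Fin n) :
    past (Fin.snoc (α := fun _ => A) y a : Fin (n + 1) → A) k.castSucc = past y k := by
  funext j
  have : (⟨j, j.isLt.trans k.castSucc.isLt⟩ : Fin (n + 1)) =
      Fin.castSucc ⟨j, j.isLt.trans k.isLt⟩ := rfl
  simp only [past]
  rw [this, Fin.snoc_castSucc]

lemma past_snoc_last (y : Fin n → A) (a : A) :
    past (Fin.snoc (α := fun _ => A) y a : Fin (n + 1) → A) (Fin.last n) = y := by
  funext j
  have : (⟨j, j.isLt.trans (Fin.last n).isLt⟩ : Fin (n + 1)) = Fin.castSucc j := rfl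
  simp only [past]
  rw [this, Fin.snoc_castSucc]

lemma causalProd_snoc (κ : (k : Fin (n + 1)) → (Fin (k : ℕ) → A) → A → ℝ) (y : Fin n → A)
    (a : A) :
    causalProd κ (Fin.snoc (α := fun _ => A) y a) =
      causalProd (fun k : Fin n => κ k.castSucc) y * κ (Fin.last n) y a := by
  unfold causalProd
  rw [Fin.prod_univ_castSucc, past_snoc_last, Fin.snoc_last]
  congr 1
  refine Finset.prod_congr rfl fun k _ => ?_
  rw [past_snoc_castSucc, Fin.snoc_castSucc]

lemma causalProd_nonneg {κ : (k : Fin n) → (Fin (k : ℕ) → A) → A → ℝ}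
    (hκ : ∀ k p a, 0 ≤ κ k p a) (y : Fin n → A) : 0 ≤ causalProd κ y :=
  Finset.prod_nonneg fun _ _ => hκ _ _ _

lemma sum_snoc [Fintype A] (f : (Fin (n + 1) → A) → ℝ) :
    ∑ y, f y = ∑ y : Fin n → A, ∑ a, f (Fin.snoc (α := fun _ => A) y a) := by
  rw [← (Fin.snocEquiv fun _ : Fin (n + 1) => A).sum_comp, Fintype.sum_prod_type,
    Finset.sum_comm]
  rfl

lemma sum_causalProd [Fintype A] (κ : (k : Fin n) → (Fin (k : ℕ) → A) → A → ℝ)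
    (hκ : ∀ k p, ∑ a, κ k p a = 1) : ∑ y, causalProd κ y = 1 := by
  induction n with
  | zero => simp [causalProd]
  | succ n ih =>
    rw [sum_snoc]
    simp_rw [causalProd_snoc, ← Finset.mul_sum, hκ, mul_one]
    exact ih (fun k : Fin n => κ k.castSucc) fun k p => hκ k.castSucc p

/-- Given the entries before time `k`, the entry at time `k` has law `κ k`. -/
lemma sum_causalProd_mul_eq [Fintype A] (κ : (k : Fin n) → (Fin (k : ℕ) → A) → A → ℝ)
    (hκ : ∀ k p, ∑ a, κ k p a = 1) (k : Fin n) (G : (Fin (k : ℕ) → A) → A → ℝ) :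
    ∑ y, causalProd κ y * G (past y k) (y k) =
      ∑ y, causalProd κ y * ∑ a, κ k (past y k) a * G (past y k) a := by
  induction n with
  | zero => exact k.elim0
  | succ n ih =>
    rw [sum_snoc, sum_snoc]
    refine Fin.lastCases (fun G => ?_) (fun k G => ?_) k G
    · simp_rw [past_snoc_last, Fin.snoc_last, causalProd_snoc]
      refine Finset.sum_congr rfl fun y _ => ?_
      rw [← Finset.sum_mul, ← Finset.mul_sum, hκ, mul_one, Finset.mul_sum]
      exact Finset.sum_congr rfl fun a _ => by ring
    · simp_rw [past_snoc_castSucc, Fin.snoc_castSucc, causalProd_snoc]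
      have := ih (fun k : Fin n => κ k.castSucc) (fun k p => hκ k.castSucc p) k G
      -- The factor at the last time integrates to one because `G` only sees earlier entries.
      have h1 : ∀ y : Fin n → A, ∀ c : ℝ,
          ∑ a, causalProd (fun k : Fin n => κ k.castSucc) y * κ (Fin.last n) y a * c =
          causalProd (fun k : Fin n => κ k.castSucc) y * c := by
        intro y c
        rw [← Finset.sum_mul, ← Finset.mul_sum, hκ, mul_one]
      simp_rw [h1]
      exact this

open Classical in
/-- If the image of `κ` under `π` is dominated by a kernel `μ` that sees only the images of the
past entries, then so is the image of the product. -/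
lemma sum_causalProd_comp_le [Fintype A] [Fintype B] (π : A → B)
    (κ : (k : Fin n) → (Fin (k : ℕ) → A) → A → ℝ) (hκ : ∀ k p a, 0 ≤ κ k p a)
    (μ : (k : Fin n) → (Fin (k : ℕ) → B) → B → ℝ) (hμ : ∀ k p b, 0 ≤ μ k p b)
    (hle : ∀ k p b, ∑ a, (if π a = b then κ k p a else 0) ≤ μ k (π ∘ p) b)
    (F : (Fin n → B) → ℝ) (hF : ∀ b, 0 ≤ F b) :
    ∑ y, causalProd κ y * F (π ∘ y) ≤ ∑ b, causalProd μ b * F b := by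
  induction n with
  | zero =>
    have : ∀ y : Fin 0 → A, π ∘ y = default := fun y => Subsingleton.elim _ _
    simp [causalProd, this]
  | succ n ih =>
    rw [sum_snoc, sum_snoc]
    have hpi : ∀ (y : Fin n → A) (a : A), π ∘ (Fin.snoc (α := fun _ => A) y a : Fin (n + 1) → A) =
        Fin.snoc (α := fun _ => B) (π ∘ y) (π a) := fun y a => by
      rw [Fin.comp_snoc]
    simp_rw [causalProd_snoc, hpi]
    -- Integrating the last entry against `μ` leaves a test function of the shorter sequence, to
    -- which the induction hypothesis applies.
    let G : (Fin n → B) → ℝ := fun b =>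
      ∑ c, μ (Fin.last n) b c * F (Fin.snoc (α := fun _ => B) b c)
    have hG : ∀ b, 0 ≤ G b := fun b => Finset.sum_nonneg fun c _ => mul_nonneg (hμ _ _ _) (hF _)
    have key := ih (fun k : Fin n => κ k.castSucc) (fun k p a => hκ k.castSucc p a)
      (fun k : Fin n => μ k.castSucc) (fun k p b => hμ k.castSucc p b)
      (fun k p b => hle k.castSucc p b) G hG
    refine le_trans (Finset.sum_le_sum fun y _ => ?_) (key.trans_eq ?_)
    · simp_rw [mul_assoc, ← Finset.mul_sum]
      refine mul_le_mul_of_nonneg_left ?_ (causalProd_nonneg (fun k p a => hκ k.castSucc p a) y)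
      calc ∑ a, κ (Fin.last n) y a * F (Fin.snoc (α := fun _ => B) (π ∘ y) (π a))
          = ∑ a, ∑ c, (if π a = c then κ (Fin.last n) y a else 0) *
              F (Fin.snoc (α := fun _ => B) (π ∘ y) c) := by
            refine Finset.sum_congr rfl fun a _ => ?_
            simp [ite_mul]
        _ = ∑ c, (∑ a, if π a = c then κ (Fin.last n) y a else 0) *
              F (Fin.snoc (α := fun _ => B) (π ∘ y) c) := by
            rw [Finset.sum_comm]
            simp_rw [Finset.sum_mul]
        _ ≤ G (π ∘ y) := Finset.sum_le_sum fun c _ =>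
            mul_le_mul_of_nonneg_right (hle (Fin.last n) y c) (hF _)
    · refine Finset.sum_congr rfl fun b _ => ?_
      rw [Finset.mul_sum]
      exact Finset.sum_congr rfl fun c _ => by ring

/-- Collapsing every entry to a point makes the constant kernel 1 dominate. -/
lemma sum_causalProd_le_one [Fintype A] (κ : (k : Fin n) → (Fin (k : ℕ) → A) → A → ℝ)
    (hκ : ∀ k p a, 0 ≤ κ k p a) (hκ1 : ∀ k p, ∑ a, κ k p a ≤ 1) : ∑ y, causalProd κ y ≤ 1 := by
  have := sum_causalProd_comp_le (fun _ : A => ()) κ hκ (fun _ _ _ => 1)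
    (fun _ _ _ => zero_le_one) (fun k p b => by simpa using hκ1 k p) (fun _ => 1)
    (fun _ => zero_le_one)
  simpa [causalProd] using this

open Classical in
/-- One-shot converse: a change of measure from the kernel `κ` to `κ * ρ`, whose image under `π`
is dominated by a kernel that does not depend on the message `u`, bounds the number of messages. -/
lemma logb_card_le {U V : Type*} [Fintype U] [Fintype V] [Nonempty U] [Nonempty V]
    [Fintype A] [Fintype B] (π : A → B)
    (κ ρ : U → V → (k : Fin n) → (Fin (k : ℕ) → A) → A → ℝ)
    (hκ : ∀ u v k p a, 0 ≤ κ u v k p a) (hκ1 : ∀ u v k p, ∑ a, κ u v k p a = 1)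
    (hρ : ∀ u v k p a, 0 ≤ ρ u v k p a)
    (hpos : ∀ u v y, causalProd (κ u v) y ≠ 0 → ∀ k, 0 < ρ u v k (past y k) (y k))
    (μ : V → (k : Fin n) → (Fin (k : ℕ) → B) → B → ℝ) (hμ : ∀ v k p b, 0 ≤ μ v k p b)
    (hμ1 : ∀ v k p, ∑ b, μ v k p b ≤ 1)
    (hle : ∀ u v k p b, ∑ a, (if π a = b then κ u v k p a * ρ u v k p a else 0) ≤
      μ v k (π ∘ p) b)
    (dec : V → (Fin n → B) → Option U) :
    (1 - (∑ u, ∑ v, ∑ y, if dec v (π ∘ y) = some u then 0 else causalProd (κ u v) y) /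
        (Fintype.card U * Fintype.card V)) * Real.logb 2 (Fintype.card U) - 2 ≤
      ∑ k, (∑ u, ∑ v, ∑ y, causalProd (κ u v) y * -Real.logb 2 (ρ u v k (past y k) (y k))) /
        (Fintype.card U * Fintype.card V) := by
  set M : ℝ := ((Fintype.card U : ℕ) : ℝ) with hM
  set M' : ℝ := ((Fintype.card V : ℕ) : ℝ) with hM'
  have hM0 : 0 < M := by rw [hM]; exact_mod_cast Fintype.card_pos
  have hM'0 : 0 < M' := by rw [hM']; exact_mod_cast Fintype.card_pos
  have hl2 : 0 < Real.log 2 := Real.log_pos one_lt_two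
  let κ' : U → V → (k : Fin n) → (Fin (k : ℕ) → A) → A → ℝ :=
    fun u v k p a => κ u v k p a * ρ u v k p a
  have hκ' : ∀ u v k p a, 0 ≤ κ' u v k p a := fun u v k p a => mul_nonneg (hκ _ _ _ _ _) (hρ _ _ _ _ _)
  let d : U → V → (Fin n → B) → ℝ := fun u v b => if dec v b = some u then 1 else 0
  have hd : ∀ u v b, 0 ≤ d u v b := fun u v b => by simp only [d]; split_ifs <;> norm_num
  have hprod : ∀ u v y, causalProd (κ' u v) y =
      causalProd (κ u v) y * ∏ k, ρ u v k (past y k) (y k) := fun u v y => by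
    simp only [causalProd, κ', Finset.prod_mul_distrib]
  have hpt : ∀ u v y, causalProd (κ u v) y *
      (d u v (π ∘ y) * Real.logb 2 M + ∑ k, Real.logb 2 (ρ u v k (past y k) (y k))) ≤
      (causalProd (κ' u v) y * (1 + M * d u v (π ∘ y)) - causalProd (κ u v) y) / Real.log 2 := by
    intro u v y
    have hP := causalProd_nonneg (hκ u v) y
    -- Off the support the ratio may vanish and its logarithm is meaningless, but both sides are
    -- then 0.
    rcases eq_or_ne (causalProd (κ u v) y) 0 with h0 | h0
    · rw [hprod, h0]; simp
    have hr := hpos u v y h0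
    set R := ∏ k, ρ u v k (past y k) (y k) with hR
    have hR0 : 0 < R := Finset.prod_pos fun k _ => hr k
    have hlR : ∑ k, Real.logb 2 (ρ u v k (past y k) (y k)) = Real.log R / Real.log 2 := by
      rw [hR, Real.log_prod fun k _ => (hr k).ne', Finset.sum_div]
      rfl
    rw [hlR, hprod]
    -- This is `log t ≤ t - 1` at `t = M * R` after correct decoding and at `t = R` otherwise; the
    -- weight `1 + M * d` covers both cases.
    have hz : d u v (π ∘ y) * Real.log M + Real.log R ≤ R * (1 + M * d u v (π ∘ y)) - 1 := by
      simp only [d]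
      split_ifs
      · have := Real.log_le_sub_one_of_pos (mul_pos hM0 hR0)
        rw [Real.log_mul hM0.ne' hR0.ne'] at this
        nlinarith
      · have := Real.log_le_sub_one_of_pos hR0
        linarith
    rw [le_div_iff₀ hl2]
    have : causalProd (κ u v) y * (d u v (π ∘ y) * Real.logb 2 M + Real.log R / Real.log 2) *
        Real.log 2 = causalProd (κ u v) y * (d u v (π ∘ y) * Real.log M + Real.log R) := by
      unfold Real.logb; field_simp
    rw [this]
    calc _ ≤ _ := mul_le_mul_of_nonneg_left hz hP
      _ = _ := by rw [← hR]; ring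
  have hsum := Finset.sum_le_sum fun u (_ : u ∈ Finset.univ) =>
    Finset.sum_le_sum fun v (_ : v ∈ Finset.univ) =>
      Finset.sum_le_sum fun y (_ : y ∈ Finset.univ) => hpt u v y
  have hE1 : ∑ u, ∑ v, ∑ y, causalProd (κ u v) y = M * M' := by
    simp_rw [sum_causalProd _ (hκ1 _ _)]
    simp [hM, hM']
  have hE2 : ∑ u, ∑ v, ∑ y, causalProd (κ' u v) y ≤ M * M' := by
    have : ∀ u v, ∑ y, causalProd (κ' u v) y ≤ 1 := fun u v => by
      refine (sum_causalProd_comp_le π (κ' u v) (hκ' u v) (μ v) (hμ v) (hle u v) (fun _ => 1)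
        fun _ => zero_le_one).trans' (by simp) |>.trans ?_
      simpa using sum_causalProd_le_one (μ v) (hμ v) (hμ1 v)
    calc _ ≤ ∑ u : U, ∑ v : V, (1 : ℝ) :=
          Finset.sum_le_sum fun u _ => Finset.sum_le_sum fun v _ => this u v
      _ = _ := by simp [hM, hM']
  -- Under the dominating law, which is free of `u`, each observation is decoded to at most one `u`.
  -- Summed over all `u`, the success probability is therefore at most one for each `v`.
  have hE3 : ∑ u, ∑ v, ∑ y, causalProd (κ' u v) y * d u v (π ∘ y) ≤ M' := by
    rw [Finset.sum_comm]
    calc _ ≤ ∑ v : V, ∑ u, ∑ b, causalProd (μ v) b * d u v b :=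
          Finset.sum_le_sum fun v _ => Finset.sum_le_sum fun u _ =>
            sum_causalProd_comp_le π (κ' u v) (hκ' u v) (μ v) (hμ v) (hle u v) (d u v) (hd u v)
      _ ≤ ∑ v : V, (1 : ℝ) := Finset.sum_le_sum fun v _ => ?_
      _ = _ := by simp [hM']
    rw [Finset.sum_comm]
    refine le_trans (Finset.sum_le_sum fun b _ => ?_) (sum_causalProd_le_one (μ v) (hμ v) (hμ1 v))
    rw [← Finset.mul_sum]
    refine mul_le_of_le_one_right (causalProd_nonneg (hμ v) b) ?_
    simp only [d]
    rcases h : dec v b with _ | w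
    · simp
    · simp
  have hE4 : ∑ u, ∑ v, ∑ y, causalProd (κ u v) y * d u v (π ∘ y) =
      M * M' - ∑ u, ∑ v, ∑ y, if dec v (π ∘ y) = some u then 0 else causalProd (κ u v) y := by
    rw [← hE1, ← Finset.sum_sub_distrib]
    refine Finset.sum_congr rfl fun u _ => ?_
    rw [← Finset.sum_sub_distrib]
    refine Finset.sum_congr rfl fun v _ => ?_
    rw [← Finset.sum_sub_distrib]
    refine Finset.sum_congr rfl fun y _ => ?_
    simp only [d]
    split_ifs <;> simp
  set E := ∑ u, ∑ v, ∑ y, if dec v (π ∘ y) = some u then 0 else causalProd (κ u v) y with hE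
  set L := ∑ u, ∑ v, ∑ y, causalProd (κ u v) y *
    ∑ k, Real.logb 2 (ρ u v k (past y k) (y k)) with hL
  have hleft : ∑ u, ∑ v, ∑ y, causalProd (κ u v) y *
      (d u v (π ∘ y) * Real.logb 2 M + ∑ k, Real.logb 2 (ρ u v k (past y k) (y k))) =
      (M * M' - E) * Real.logb 2 M + L := by
    rw [← hE4, hL]
    simp_rw [mul_add, Finset.sum_add_distrib, Finset.sum_mul, mul_assoc]
  have hright : ∑ u, ∑ v, ∑ y, (causalProd (κ' u v) y * (1 + M * d u v (π ∘ y)) -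
      causalProd (κ u v) y) / Real.log 2 ≤ M * M' / Real.log 2 := by
    simp_rw [← Finset.sum_div]
    gcongr
    have : ∑ u, ∑ v, ∑ y, (causalProd (κ' u v) y * (1 + M * d u v (π ∘ y)) -
      causalProd (κ u v) y) = ∑ u, ∑ v, ∑ y, causalProd (κ' u v) y +
        M * ∑ u, ∑ v, ∑ y, causalProd (κ' u v) y * d u v (π ∘ y) - M * M' := by
      rw [← hE1]
      simp_rw [Finset.mul_sum, ← Finset.sum_add_distrib, ← Finset.sum_sub_distrib]
      refine Finset.sum_congr rfl fun u _ => Finset.sum_congr rfl fun v _ =>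
        Finset.sum_congr rfl fun y _ => by ring
    rw [this]
    nlinarith
  -- The loss of two bits in the statement is a rounding up of `1 / log 2`.
  have h2 : M * M' / Real.log 2 ≤ 2 * (M * M') := by
    rw [div_le_iff₀ hl2]
    have := Real.log_two_gt_d9
    have hMM := mul_pos hM0 hM'0
    nlinarith
  have hgoal : ∑ k, (∑ u, ∑ v, ∑ y, causalProd (κ u v) y *
      -Real.logb 2 (ρ u v k (past y k) (y k))) / (M * M') = -L / (M * M') := by
    rw [← Finset.sum_div, hL, Finset.sum_comm, ← Finset.sum_neg_distrib]
    congr 1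
    refine Finset.sum_congr rfl fun u _ => ?_
    rw [Finset.sum_comm, ← Finset.sum_neg_distrib]
    refine Finset.sum_congr rfl fun v _ => ?_
    rw [Finset.sum_comm, ← Finset.sum_neg_distrib]
    refine Finset.sum_congr rfl fun y _ => ?_
    simp [Finset.mul_sum]
  rw [hgoal, le_div_iff₀ (mul_pos hM0 hM'0)]
  have h3 : ((1 - E / (M * M')) * Real.logb 2 M - 2) * (M * M') =
      (M * M' - E) * Real.logb 2 M - 2 * (M * M') := by
    field_simp
  rw [h3]
  linarith

end Causal

/-! ### Single-letter information as an expected log likelihood ratio -/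

section SingleLetter

variable {𝒳 𝒵 A C G : Type*}

lemma marginal_nonneg {Ω α : Type*} [Fintype Ω] {p : Ω → ℝ} (hp : ∀ ω, 0 ≤ p ω) (f : Ω → α)
    (a : α) : 0 ≤ marginal p f a :=
  Finset.sum_nonneg fun ω _ => by split_ifs; exacts [hp ω, le_rfl]

lemma le_marginal {Ω α : Type*} [Fintype Ω] {p : Ω → ℝ} (hp : ∀ ω, 0 ≤ p ω) (f : Ω → α)
    (ω : Ω) : p ω ≤ marginal p f (f ω) := by
  classical
  unfold marginal
  refine le_trans ?_ (Finset.single_le_sum (f := fun ω' => if f ω' = f ω then p ω' else 0)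
    (fun ω' _ => ?_) (Finset.mem_univ ω))
  · simp
  · split_ifs; exacts [hp _, le_rfl]

lemma sum_marginal_mul {Ω α : Type*} [Fintype Ω] [Fintype α] (p : Ω → ℝ) (f : Ω → α)
    (F : α → ℝ) : ∑ a, marginal p f a * F a = ∑ ω, p ω * F (f ω) := by
  classical
  simp_rw [marginal, Finset.sum_mul]
  rw [Finset.sum_comm]
  refine Finset.sum_congr rfl fun ω _ => ?_
  simp [ite_mul]

lemma sum_marginal {Ω α : Type*} [Fintype Ω] [Fintype α] (p : Ω → ℝ) (f : Ω → α) :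
    ∑ a, marginal p f a = ∑ ω, p ω := by
  simpa using sum_marginal_mul p f fun _ => 1

/-- The joint law of an input with law `ν` and the output of the channel `W`. -/
def joint (ν : 𝒳 → ℝ) (W : 𝒳 → A → ℝ) : 𝒳 × A → ℝ := fun ω => ν ω.1 * W ω.1 ω.2

/-- The conditional probability of `φ = c` given `g = γ` when the channel input has law `ν`. -/
noncomputable def condOut [Fintype 𝒳] [Fintype A] (ν : 𝒳 → ℝ) (W : 𝒳 → A → ℝ) (φ : A → C)
    (g : 𝒳 → G) (c : C) (γ : G) : ℝ :=
  marginal (joint ν W) (fun ω => (φ ω.2, g ω.1)) (c, γ) / marginal ν g γ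

/-- The likelihood ratio of the observation given `g` and given the complete input. -/
noncomputable def ratio [Fintype 𝒳] [Fintype A] (ν : 𝒳 → ℝ) (W : 𝒳 → A → ℝ) (φ : A → C)
    (g : 𝒳 → G) (x : 𝒳) (a : A) : ℝ :=
  condOut ν W φ g (φ a) (g x) / marginal (W x) φ (φ a)

/-- The mutual information of the input and the observation `φ` given the part `g` of the input,
as the expected logarithm of a likelihood ratio. -/
noncomputable def channelInfo [Fintype 𝒳] [Fintype A] (ν : 𝒳 → ℝ) (W : 𝒳 → A → ℝ) (φ : A → C)
    (g : 𝒳 → G) : ℝ :=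
  ∑ x, ν x * ∑ a, W x a * -Real.logb 2 (ratio ν W φ g x a)

variable [Fintype 𝒳] [Fintype 𝒵] [Fintype A]

lemma marginal_joint (ν : 𝒳 → ℝ) (W : 𝒳 → A → ℝ) (φ : A → C) (g : 𝒳 → G) (c : C) (γ : G) :
    marginal (joint ν W) (fun ω => (φ ω.2, g ω.1)) (c, γ) =
      marginal (fun x => ν x * marginal (W x) φ c) g γ := by
  classical
  simp only [marginal, joint, Fintype.sum_prod_type, Prod.mk.injEq]
  refine Finset.sum_congr rfl fun x _ => ?_
  by_cases h : g x = γ <;> simp [h, Finset.mul_sum]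

lemma condOut_eq (ν : 𝒳 → ℝ) (W : 𝒳 → A → ℝ) (φ : A → C) (g : 𝒳 → G) (c : C) (γ : G) :
    condOut ν W φ g c γ = marginal (fun x => ν x * marginal (W x) φ c) g γ / marginal ν g γ := by
  rw [condOut, marginal_joint]

lemma joint_nonneg {ν : 𝒳 → ℝ} {W : 𝒳 → A → ℝ} (hν : ∀ x, 0 ≤ ν x) (hW : ∀ x a, 0 ≤ W x a)
    (ω : 𝒳 × A) : 0 ≤ joint ν W ω := mul_nonneg (hν _) (hW _ _)

lemma condOut_nonneg {ν : 𝒳 → ℝ} {W : 𝒳 → A → ℝ} (hν : ∀ x, 0 ≤ ν x) (hW : ∀ x a, 0 ≤ W x a)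
    (φ : A → C) (g : 𝒳 → G) (c : C) (γ : G) : 0 ≤ condOut ν W φ g c γ :=
  div_nonneg (marginal_nonneg (joint_nonneg hν hW) _ _) (marginal_nonneg hν _ _)

/-- Equality fails only where `g` takes a value of zero mass: division by zero then makes the sum 0.
A subprobability is all that the converse requires. -/
lemma sum_condOut_le_one [Fintype C] {ν : 𝒳 → ℝ} {W : 𝒳 → A → ℝ} (hW1 : ∀ x, ∑ a, W x a = 1)
    (φ : A → C) (g : 𝒳 → G) (γ : G) : ∑ c, condOut ν W φ g c γ ≤ 1 := by
  classical
  have : ∑ c, marginal (joint ν W) (fun ω => (φ ω.2, g ω.1)) (c, γ) = marginal ν g γ := by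
    simp_rw [marginal_joint]
    unfold marginal
    rw [Finset.sum_comm]
    refine Finset.sum_congr rfl fun x _ => ?_
    by_cases h : g x = γ
    · simp only [h, if_true, ← Finset.mul_sum]
      have := sum_marginal (W x) φ
      unfold marginal at this
      rw [this, hW1, mul_one]
    · simp [h]
  simp_rw [condOut]
  rw [← Finset.sum_div, this]
  exact div_self_le_one _

lemma ratio_nonneg {ν : 𝒳 → ℝ} {W : 𝒳 → A → ℝ} (hν : ∀ x, 0 ≤ ν x) (hW : ∀ x a, 0 ≤ W x a)
    (φ : A → C) (g : 𝒳 → G) (x : 𝒳) (a : A) : 0 ≤ ratio ν W φ g x a :=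
  div_nonneg (condOut_nonneg hν hW _ _ _ _) (marginal_nonneg (hW x) _ _)

lemma ratio_pos {ν : 𝒳 → ℝ} {W : 𝒳 → A → ℝ} (hν : ∀ x, 0 ≤ ν x) (hW : ∀ x a, 0 ≤ W x a)
    (φ : A → C) (g : 𝒳 → G) {x : 𝒳} {a : A} (hx : 0 < ν x) (ha : 0 < W x a) :
    0 < ratio ν W φ g x a := by
  have h1 := (mul_pos hx ha).trans_le (le_marginal (joint_nonneg hν hW)
    (fun ω : 𝒳 × A => (φ ω.2, g ω.1)) (x, a))
  have h2 := hx.trans_le (le_marginal hν g x)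
  have h3 := ha.trans_le (le_marginal (hW x) φ a)
  exact div_pos (div_pos h1 h2) h3

/-- The ratio cancels the law of the observation given the full input and puts the law given `g` in
its place. Observations impossible under `x` are lost, whence the inequality. -/
lemma sum_mul_ratio_le [DecidableEq C] {ν : 𝒳 → ℝ} {W : 𝒳 → A → ℝ} (hν : ∀ x, 0 ≤ ν x)
    (hW : ∀ x a, 0 ≤ W x a) (φ : A → C) (g : 𝒳 → G) (x : 𝒳) (c : C) :
    ∑ a, (if φ a = c then W x a * ratio ν W φ g x a else 0) ≤ condOut ν W φ g c (g x) := by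
  have h : ∑ a, (if φ a = c then W x a * ratio ν W φ g x a else 0) =
      marginal (W x) φ c * (condOut ν W φ g c (g x) / marginal (W x) φ c) := by
    classical
    nth_rw 1 [marginal]
    rw [Finset.sum_mul]
    refine Finset.sum_congr rfl fun a _ => ?_
    by_cases h : φ a = c <;> simp [h, ratio]
  rw [h]
  rcases eq_or_ne (marginal (W x) φ c) 0 with h0 | h0
  · rw [h0, zero_mul]; exact condOut_nonneg hν hW _ _ _ _
  · rw [mul_div_cancel₀ _ h0]

open Classical in
/-- The law of the channel input at time `k`, for uniformly distributed messages. -/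
noncomputable def inputLaw {U V : Type*} [Fintype U] [Fintype V] {n : ℕ} (W : 𝒳 → A → ℝ)
    (inp : U → V → (k : Fin n) → (Fin (k : ℕ) → A) → 𝒳) (k : Fin n) (x : 𝒳) : ℝ :=
  (∑ u, ∑ v, ∑ y, if inp u v k (past y k) = x then
    causalProd (fun k p => W (inp u v k p)) y else 0) / (Fintype.card U * Fintype.card V)

lemma sum_inputLaw_mul {U V : Type*} [Fintype U] [Fintype V] {n : ℕ} (W : 𝒳 → A → ℝ)
    (inp : U → V → (k : Fin n) → (Fin (k : ℕ) → A) → 𝒳) (k : Fin n) (F : 𝒳 → ℝ) :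
    ∑ x, inputLaw W inp k x * F x =
      (∑ u, ∑ v, ∑ y, causalProd (fun k p => W (inp u v k p)) y * F (inp u v k (past y k))) /
        (Fintype.card U * Fintype.card V) := by
  classical
  simp_rw [inputLaw, div_mul_eq_mul_div, ← Finset.sum_div]
  congr 1
  simp_rw [Finset.sum_mul]
  rw [Finset.sum_comm]
  refine Finset.sum_congr rfl fun u _ => ?_
  rw [Finset.sum_comm]
  refine Finset.sum_congr rfl fun v _ => ?_
  rw [Finset.sum_comm]
  refine Finset.sum_congr rfl fun y _ => ?_
  simp [ite_mul]

lemma inputLaw_nonneg {U V : Type*} [Fintype U] [Fintype V] {n : ℕ} {W : 𝒳 → A → ℝ}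
    (hW : ∀ x a, 0 ≤ W x a) (inp : U → V → (k : Fin n) → (Fin (k : ℕ) → A) → 𝒳) (k : Fin n)
    (x : 𝒳) : 0 ≤ inputLaw W inp k x := by
  refine div_nonneg (Finset.sum_nonneg fun u _ => Finset.sum_nonneg fun v _ =>
    Finset.sum_nonneg fun y _ => ?_) (by positivity)
  split_ifs
  exacts [causalProd_nonneg (fun _ _ _ => hW _ _) _, le_rfl]

lemma inputLaw_pos {U V : Type*} [Fintype U] [Fintype V] [Nonempty U] [Nonempty V] {n : ℕ}
    {W : 𝒳 → A → ℝ} (hW : ∀ x a, 0 ≤ W x a)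
    (inp : U → V → (k : Fin n) → (Fin (k : ℕ) → A) → 𝒳) (k : Fin n) (u : U) (v : V)
    (y : Fin n → A) (h : causalProd (fun k p => W (inp u v k p)) y ≠ 0) :
    0 < inputLaw W inp k (inp u v k (past y k)) := by
  have hP : ∀ u v y, 0 ≤ causalProd (fun k p => W (inp u v k p)) y := fun u v y =>
    causalProd_nonneg (fun _ _ _ => hW _ _) _
  have hU : (0 : ℝ) < Fintype.card U := by exact_mod_cast Fintype.card_pos
  have hV : (0 : ℝ) < Fintype.card V := by exact_mod_cast Fintype.card_pos
  refine div_pos ?_ (mul_pos hU hV)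
  refine Finset.sum_pos' (fun u _ => Finset.sum_nonneg fun v _ => Finset.sum_nonneg fun y _ => ?_)
    ⟨u, Finset.mem_univ _, Finset.sum_pos' (fun v _ => Finset.sum_nonneg fun y _ => ?_)
    ⟨v, Finset.mem_univ _, Finset.sum_pos' (fun y _ => ?_) ⟨y, Finset.mem_univ _, ?_⟩⟩⟩
  · split_ifs; exacts [hP _ _ _, le_rfl]
  · split_ifs; exacts [hP _ _ _, le_rfl]
  · split_ifs; exacts [hP _ _ _, le_rfl]
  · rw [if_pos rfl]; exact lt_of_le_of_ne (hP _ _ _) h.symm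

open Classical in
/-- Single-letter form of the one-shot converse for codes with feedback: at time `k` the reference
law of the observation is the one induced by an input law `ν k`. -/
lemma logb_card_le_sum_inputLaw {U V B : Type*} [Fintype U] [Fintype V] [Nonempty U] [Nonempty V]
    [Fintype B] {n : ℕ} {W : 𝒳 → A → ℝ} (hW : ∀ x a, 0 ≤ W x a) (hW1 : ∀ x, ∑ a, W x a = 1)
    (inp : U → V → (k : Fin n) → (Fin (k : ℕ) → A) → 𝒳) (π : A → B) (g : 𝒳 → G)
    (γ : V → (k : Fin n) → (Fin (k : ℕ) → B) → G)
    (hγ : ∀ u v k p, g (inp u v k p) = γ v k (π ∘ p))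
    (ν : Fin n → 𝒳 → ℝ) (hν : ∀ k x, 0 ≤ ν k x)
    (hν' : ∀ k x, 0 < inputLaw W inp k x → 0 < ν k x)
    (dec : V → (Fin n → B) → Option U) :
    (1 - (∑ u, ∑ v, ∑ y, if dec v (π ∘ y) = some u then 0 else
          causalProd (fun k p => W (inp u v k p)) y) /
        (Fintype.card U * Fintype.card V)) * Real.logb 2 (Fintype.card U) - 2 ≤
      ∑ k, ∑ x, inputLaw W inp k x * ∑ a, W x a * -Real.logb 2 (ratio (ν k) W π g x a) := by
  -- The dominating kernel is `condOut` at `γ v k p`: by `hγ` the part `g` of the input is known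
  -- from `v` and the past observations, so `u` does not enter.
  refine (logb_card_le π (fun u v k p a => W (inp u v k p) a)
    (fun u v k p a => ratio (ν k) W π g (inp u v k p) a) (fun _ _ _ _ _ => hW _ _)
    (fun _ _ _ _ => hW1 _) (fun _ _ _ _ _ => ratio_nonneg (hν _) hW _ _ _ _)
    (fun u v y h k => ?_) (fun v k p b => condOut (ν k) W π g b (γ v k p))
    (fun _ _ _ _ => condOut_nonneg (hν _) hW _ _ _ _)
    (fun _ _ _ => sum_condOut_le_one hW1 _ _ _) (fun u v k p b => ?_) dec).trans_eq ?_
  · refine ratio_pos (hν _) hW _ _ (hν' _ _ (inputLaw_pos hW inp k u v y h)) ?_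
    refine lt_of_le_of_ne (hW _ _) (Ne.symm ?_)
    exact (Finset.prod_ne_zero_iff.mp h) k (Finset.mem_univ k)
  · rw [← hγ u]
    exact sum_mul_ratio_le (hν k) hW π g _ b
  · refine Finset.sum_congr rfl fun k _ => ?_
    rw [sum_inputLaw_mul]
    congr 1
    refine Finset.sum_congr rfl fun u _ => Finset.sum_congr rfl fun v _ => ?_
    exact sum_causalProd_mul_eq (fun k p => W (inp u v k p)) (fun _ _ => hW1 _) k
      (fun p a => -Real.logb 2 (ratio (ν k) W π g (inp u v k p) a))

lemma marginal_smul {Ω α : Type*} [Fintype Ω] (c : ℝ) (p : Ω → ℝ) (f : Ω → α) (a : α) :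
    marginal (fun ω => c * p ω) f a = c * marginal p f a := by
  simp only [marginal, Finset.mul_sum, mul_ite, mul_zero]

/-- The likelihood ratio is invariant under scaling of the input law. Hence a sum of input laws over
a phase carries the length of the phase times the information of their average. -/
lemma channelInfo_smul (c : ℝ) (ν : 𝒳 → ℝ) (W : 𝒳 → A → ℝ) (φ : A → C) (g : 𝒳 → G) :
    channelInfo (fun x => c * ν x) W φ g = c * channelInfo ν W φ g := by
  rcases eq_or_ne c 0 with rfl | hc
  · simp [channelInfo]
  · have : ∀ x a, ratio (fun x => c * ν x) W φ g x a = ratio ν W φ g x a := fun x a => by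
      have : joint (fun x => c * ν x) W = fun ω => c * joint ν W ω := by
        funext ω; simp only [joint]; ring
      rw [ratio, ratio, condOut, condOut, this, marginal_smul, marginal_smul,
        mul_div_mul_left _ _ hc]
    simp only [channelInfo, this, Finset.mul_sum, mul_assoc]

lemma marginal_marginal {Ω α β : Type*} [Fintype Ω] [Fintype α] (p : Ω → ℝ) (f : Ω → α)
    (F : α → ℝ) (h : α → β) (b : β) :
    marginal (fun a => marginal p f a * F a) h b = marginal (fun ω => p ω * F (f ω)) (h ∘ f) b := by
  classical
  have := sum_marginal_mul p f (fun a => if h a = b then F a else 0)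
  simpa [marginal] using this

lemma channelInfo_pushforward (ν : 𝒵 → ℝ) (e : 𝒵 → 𝒳) (W : 𝒳 → A → ℝ) (φ : A → C) (g : 𝒳 → G) :
    channelInfo (marginal ν e) W φ g = channelInfo ν (fun z => W (e z)) φ (fun z => g (e z)) := by
  unfold channelInfo
  rw [sum_marginal_mul]
  have : ∀ z a, ratio (marginal ν e) W φ g (e z) a =
      ratio ν (fun z => W (e z)) φ (fun z => g (e z)) z a := fun z a => by
    rw [ratio, ratio, condOut_eq, condOut_eq, marginal_marginal]
    have := marginal_marginal ν e (fun _ => 1) g (g (e z))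
    simp only [mul_one] at this
    rw [this]
    rfl
  simp_rw [this]

/-- Only the partitions induced by `φ` and `g` matter, and for `φ` only on outputs that can occur.
This is how dummy symbols forced by the half-duplex constraint are discarded. -/
lemma channelInfo_congr {C' G' : Type*} (ν : 𝒳 → ℝ) (W : 𝒳 → A → ℝ) (φ : A → C) (g : 𝒳 → G)
    (φ' : A → C') (g' : 𝒳 → G')
    (hφ : ∀ x x' a a', W x a ≠ 0 → W x' a' ≠ 0 → (φ a = φ a' ↔ φ' a = φ' a'))
    (hg : ∀ x x', g x = g x' ↔ g' x = g' x') :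
    channelInfo ν W φ g = channelInfo ν W φ' g' := by
  classical
  refine Finset.sum_congr rfl fun x _ => ?_
  congr 1
  refine Finset.sum_congr rfl fun a _ => ?_
  rcases eq_or_ne (W x a) 0 with h0 | h0
  · simp [h0]
  have h1 : ∀ x', marginal (W x') φ (φ a) = marginal (W x') φ' (φ' a) := fun x' => by
    refine Finset.sum_congr rfl fun a' _ => ?_
    rcases eq_or_ne (W x' a') 0 with h | h
    · simp [h]
    · simp [hφ x' x a' a h h0]
  have h2 : ∀ p : 𝒳 → ℝ, marginal p g (g x) = marginal p g' (g' x) := fun p => by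
    simp only [marginal, hg _ x]
  simp only [ratio, condOut, marginal_joint, h1, h2]

/-- A trivial observation has likelihood ratio 1 on the support. -/
lemma channelInfo_of_subsingleton [Subsingleton C] {ν : 𝒳 → ℝ} {W : 𝒳 → A → ℝ}
    (hν : ∀ x, 0 ≤ ν x) (hW1 : ∀ x, ∑ a, W x a = 1) (φ : A → C) (g : 𝒳 → G) :
    channelInfo ν W φ g = 0 := by
  classical
  refine Finset.sum_eq_zero fun x _ => ?_
  rcases eq_or_ne (ν x) 0 with h0 | h0
  · simp [h0]
  have hc : ∀ x' c, marginal (W x') φ c = 1 := fun x' c => by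
    simp [marginal, Subsingleton.elim _ c, hW1]
  have hpos : 0 < marginal ν g (g x) :=
    (lt_of_le_of_ne (hν x) h0.symm).trans_le (le_marginal hν g x)
  have : ∀ a, ratio ν W φ g x a = 1 := fun a => by
    simp only [ratio, condOut, marginal_joint, hc, mul_one, div_one]
    exact div_self hpos.ne'
  simp [this]

/-- Conditioning on a time-sharing variable averages the mutual informations. -/
lemma channelInfo_timeSharing {Q : Type*} [Fintype Q] (pQ : Q → ℝ) (ν : Q → 𝒳 → ℝ)
    (W : 𝒳 → A → ℝ) (φ : A → C) (g : 𝒳 → G) :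
    channelInfo (fun z : Q × 𝒳 => pQ z.1 * ν z.1 z.2) (fun z => W z.2) φ
      (fun z => (g z.2, z.1)) = ∑ q, pQ q * channelInfo (ν q) W φ g := by
  classical
  unfold channelInfo
  rw [Fintype.sum_prod_type]
  refine Finset.sum_congr rfl fun q _ => ?_
  rcases eq_or_ne (pQ q) 0 with h0 | h0
  · simp [h0]
  rw [Finset.mul_sum]
  refine Finset.sum_congr rfl fun x _ => ?_
  rw [mul_assoc]
  congr 2
  refine Finset.sum_congr rfl fun a _ => ?_
  congr 3
  have hm : ∀ F : 𝒳 → ℝ, marginal (fun z : Q × 𝒳 => pQ z.1 * ν z.1 z.2 * F z.2)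
      (fun z => (g z.2, z.1)) (g x, q) = pQ q * marginal (fun x => ν q x * F x) g (g x) := by
    intro F
    simp only [marginal, Fintype.sum_prod_type, Prod.mk.injEq, Finset.mul_sum]
    rw [Finset.sum_eq_single q]
    · refine Finset.sum_congr rfl fun x' _ => ?_
      by_cases h : g x' = g x <;> simp [h, mul_assoc]
    · intro q' _ hq'
      simp [hq']
    · simp
  have hm1 := hm fun _ => 1
  simp only [mul_one] at hm1
  rw [ratio, ratio, condOut_eq, condOut_eq, hm1, hm fun x => marginal (W x) φ (φ a), mul_div_mul_left _ _ h0]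

/-! ### Comparison with entropies, and continuity -/

lemma marginal_joint_fst {ν : 𝒳 → ℝ} {W : 𝒳 → A → ℝ} (hW1 : ∀ x, ∑ a, W x a = 1) (k : 𝒳 → C)
    (c : C) : marginal (joint ν W) (fun ω => k ω.1) c = marginal ν k c := by
  classical
  simp only [marginal, joint, Fintype.sum_prod_type]
  refine Finset.sum_congr rfl fun x _ => ?_
  by_cases hk : k x = c <;> simp [hk, ← Finset.mul_sum, hW1]

lemma entropy_eq_sum {Ω α : Type*} [Fintype Ω] [Fintype α] (p : Ω → ℝ) (f : Ω → α) :
    entropy p f = ∑ ω, p ω * -Real.logb 2 (marginal p f (f ω)) := by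
  rw [← sum_marginal_mul p f fun a => -Real.logb 2 (marginal p f a)]
  simp [entropy]

/-- If `f` and `h` determine the channel input, `I(f ; φ | h)` is the expected logarithm of the
likelihood ratio. -/
lemma condMutualInfo_joint {F : Type*} [Fintype F] [Fintype G] [Fintype C] {ν : 𝒳 → ℝ}
    {W : 𝒳 → A → ℝ} (hν : ∀ x, 0 ≤ ν x) (hW : ∀ x a, 0 ≤ W x a) (hW1 : ∀ x, ∑ a, W x a = 1)
    (f : 𝒳 → F) (h : 𝒳 → G) (hfh : Function.Injective fun x => (f x, h x)) (φ : A → C) :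
    condMutualInfo (joint ν W) (fun ω => f ω.1) (fun ω => φ ω.2) (fun ω => h ω.1) =
      channelInfo ν W φ h := by
  classical
  have hp := joint_nonneg hν hW
  unfold condMutualInfo condEntropy
  rw [entropy_eq_sum, entropy_eq_sum, entropy_eq_sum, entropy_eq_sum, ← Finset.sum_sub_distrib,
    ← Finset.sum_sub_distrib, ← Finset.sum_sub_distrib]
  have hmi : channelInfo ν W φ h = ∑ ω : 𝒳 × A, joint ν W ω *
      -Real.logb 2 (ratio ν W φ h ω.1 ω.2) := by
    rw [channelInfo, Fintype.sum_prod_type]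
    simp [joint, Finset.mul_sum, mul_assoc]
  rw [hmi]
  refine Finset.sum_congr rfl fun ω _ => ?_
  obtain ⟨x, a⟩ := ω
  rcases (hp (x, a)).eq_or_lt with h0 | h0
  · simp [← h0]
  have hx : 0 < ν x := lt_of_le_of_ne (hν x) fun e => by simp [joint, ← e] at h0
  have ha : 0 < W x a := lt_of_le_of_ne (hW x a) fun e => by simp [joint, ← e] at h0
  -- By injectivity the event singles out the input `x`; the same holds for the next marginal.
  have e1 : marginal (joint ν W) (fun ω => (f ω.1, h ω.1)) (f x, h x) = ν x := by
    rw [marginal_joint_fst hW1 fun x => (f x, h x)]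
    simp only [marginal]
    rw [Finset.sum_eq_single x]
    · simp
    · intro x' _ hx'
      rw [if_neg fun e => hx' (hfh e)]
    · simp
  have e2 : marginal (joint ν W) (fun ω => (f ω.1, φ ω.2, h ω.1)) (f x, φ a, h x) =
      ν x * marginal (W x) φ (φ a) := by
    simp only [marginal, joint, Fintype.sum_prod_type]
    rw [Finset.sum_eq_single x]
    · simp [Finset.mul_sum]
    · intro x' _ hx'
      refine Finset.sum_eq_zero fun a' _ => if_neg fun e => hx' (hfh ?_)
      simp only [Prod.mk.injEq] at e ⊢
      exact ⟨e.1, e.2.2⟩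
    · simp
  have e3 := marginal_joint_fst (ν := ν) hW1 h (h x)
  have p1 := h0.trans_le (le_marginal hp (fun ω : 𝒳 × A => (φ ω.2, h ω.1)) (x, a))
  have p2 := hx.trans_le (le_marginal hν h x)
  have p3 := ha.trans_le (le_marginal (hW x) φ a)
  simp only at e1 e2 e3 p1 ⊢
  rw [e1, e2, e3, ratio, condOut, Real.logb_div (div_pos p1 p2).ne' p3.ne',
    Real.logb_div p1.ne' p2.ne', Real.logb_mul hx.ne' p3.ne']
  ring

lemma entropy_equiv {Ω Ω' α : Type*} [Fintype Ω] [Fintype Ω'] [Fintype α] (e : Ω ≃ Ω')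
    (p : Ω' → ℝ) (f : Ω' → α) :
    entropy (fun ω => p (e ω)) (fun ω => f (e ω)) = entropy p f := by
  classical
  have hm : ∀ a, marginal (fun ω => p (e ω)) (fun ω => f (e ω)) a = marginal p f a := fun a =>
    e.sum_comp fun ω => if f ω = a then p ω else 0
  simp only [entropy, hm]

lemma condMutualInfo_equiv {Ω Ω' α β γ : Type*} [Fintype Ω] [Fintype Ω'] [Fintype α] [Fintype β]
    [Fintype γ] (e : Ω ≃ Ω') (p : Ω' → ℝ) (f : Ω' → α) (g : Ω' → β) (h : Ω' → γ) :
    condMutualInfo (fun ω => p (e ω)) (fun ω => f (e ω)) (fun ω => g (e ω)) (fun ω => h (e ω)) =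
      condMutualInfo p f g h := by
  unfold condMutualInfo condEntropy
  rw [← entropy_equiv e p h, ← entropy_equiv e p fun ω => (f ω, h ω),
    ← entropy_equiv e p fun ω => (g ω, h ω), ← entropy_equiv e p fun ω => (f ω, g ω, h ω)]

lemma continuous_entropy {Ω α : Type*} [Fintype Ω] [Fintype α] (f : Ω → α) :
    Continuous fun p : Ω → ℝ => entropy p f := by
  classical
  unfold entropy
  refine continuous_finsetSum _ fun a _ => ?_
  have hm : Continuous fun p : Ω → ℝ => marginal p f a :=
    continuous_finsetSum _ fun ω _ => by split_ifs <;> fun_prop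
  -- In the form `t log t` the function is continuous at 0 as well, where the logarithm alone is
  -- not.
  have : (fun p : Ω → ℝ => -(marginal p f a * Real.logb 2 (marginal p f a))) =
      fun p => -(marginal p f a * Real.log (marginal p f a)) / Real.log 2 := by
    funext p; unfold Real.logb; ring
  rw [this]
  exact ((Real.continuous_mul_log.comp hm).neg).div_const _

lemma continuous_condMutualInfo {Ω α β γ : Type*} [Fintype Ω] [Fintype α] [Fintype β] [Fintype γ]
    (f : Ω → α) (g : Ω → β) (h : Ω → γ) :
    Continuous fun p : Ω → ℝ => condMutualInfo p f g h := by
  unfold condMutualInfo condEntropy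
  exact ((continuous_entropy _).sub (continuous_entropy _)).sub
    ((continuous_entropy _).sub (continuous_entropy _))

end SingleLetter

/-! ### Pooling the reference laws of one phase -/

section TwoPhase

variable {𝒳 A G : Type*} [Fintype 𝒳] [Fintype A]

open Classical in
/-- One-shot converse with separate reference laws at the times in `S` and a common reference law
at all other times. -/
lemma logb_card_le_sum_add {U V B : Type*} [Fintype U] [Fintype V] [Nonempty U] [Nonempty V]
    [Fintype B] {n : ℕ} {W : 𝒳 → A → ℝ} (hW : ∀ x a, 0 ≤ W x a) (hW1 : ∀ x, ∑ a, W x a = 1)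
    (inp : U → V → (k : Fin n) → (Fin (k : ℕ) → A) → 𝒳) (π : A → B) (g : 𝒳 → G)
    (γ : V → (k : Fin n) → (Fin (k : ℕ) → B) → G)
    (hγ : ∀ u v k p, g (inp u v k p) = γ v k (π ∘ p)) (S : Finset (Fin n))
    (dec : V → (Fin n → B) → Option U) :
    (1 - (∑ u, ∑ v, ∑ y, if dec v (π ∘ y) = some u then 0 else
          causalProd (fun k p => W (inp u v k p)) y) /
        (Fintype.card U * Fintype.card V)) * Real.logb 2 (Fintype.card U) - 2 ≤
      ∑ k ∈ S, channelInfo (inputLaw W inp k) W π g +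
        channelInfo (fun x => ∑ k ∈ Sᶜ, inputLaw W inp k x) W π g := by
  have h0 := inputLaw_nonneg hW inp
  -- With a pooled reference law the log ratio is the same at all times in `Sᶜ`, so summing the
  -- input laws against it reproduces `channelInfo` of the pool. The pool charges every input that
  -- one of its members charges, as the converse demands.
  refine (logb_card_le_sum_inputLaw hW hW1 inp π g γ hγ
    (fun k x => if k ∈ S then inputLaw W inp k x else ∑ k ∈ Sᶜ, inputLaw W inp k x)
    (fun k x => ?_) (fun k x hx => ?_) dec).trans_eq ?_
  · split_ifs
    exacts [h0 k x, Finset.sum_nonneg fun k _ => h0 k x]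
  · split_ifs with hk
    · exact hx
    · exact hx.trans_le (Finset.single_le_sum (f := fun k => inputLaw W inp k x)
        (fun k _ => h0 k x) (Finset.mem_compl.mpr hk))
  · rw [← Finset.sum_add_sum_compl S]
    congr 1
    · refine Finset.sum_congr rfl fun k hk => ?_
      simp only [hk, if_true]
      rfl
    · unfold channelInfo
      simp_rw [Finset.sum_mul]
      conv_rhs => rw [Finset.sum_comm]
      refine Finset.sum_congr rfl fun k hk => ?_
      simp only [Finset.mem_compl.mp hk, if_false]

lemma exists_of_inputLaw_ne_zero {U V : Type*} [Fintype U] [Fintype V] {n : ℕ} {W : 𝒳 → A → ℝ}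
    {inp : U → V → (k : Fin n) → (Fin (k : ℕ) → A) → 𝒳} {k : Fin n} {x : 𝒳}
    (h : inputLaw W inp k x ≠ 0) : ∃ u v y, inp u v k (past y k) = x ∧
      causalProd (fun k p => W (inp u v k p)) y ≠ 0 := by
  contrapose! h
  unfold inputLaw
  refine div_eq_zero_iff.mpr (Or.inl (Finset.sum_eq_zero fun u _ => Finset.sum_eq_zero fun v _ =>
    Finset.sum_eq_zero fun y _ => ?_))
  split_ifs with hx
  exacts [h u v y hx, rfl]

lemma sum_inputLaw {U V : Type*} [Fintype U] [Fintype V] [Nonempty U] [Nonempty V] {n : ℕ}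
    {W : 𝒳 → A → ℝ} (hW1 : ∀ x, ∑ a, W x a = 1)
    (inp : U → V → (k : Fin n) → (Fin (k : ℕ) → A) → 𝒳) (k : Fin n) :
    ∑ x, inputLaw W inp k x = 1 := by
  have := sum_inputLaw_mul W inp k fun _ => 1
  simp only [mul_one, sum_causalProd _ fun _ _ => hW1 _] at this
  rw [this]
  simp

/-- Lets the direction from `b` to `a` be treated with the roles of the two messages exchanged. -/
lemma inputLaw_swap {U V : Type*} [Fintype U] [Fintype V] {n : ℕ} (W : 𝒳 → A → ℝ)
    (inp : U → V → (k : Fin n) → (Fin (k : ℕ) → A) → 𝒳) :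
    inputLaw W (fun v u => inp u v) = inputLaw W inp := by
  funext k x
  simp only [inputLaw]
  rw [Finset.sum_comm, mul_comm]

/-- No mass is moved when `e` undoes `d` on the support. It serves to pass between inputs with dummy
symbols and genuine symbols. -/
lemma marginal_marginal_of_leftInv {α : Type*} [Fintype α] (ν : 𝒳 → ℝ) (d : 𝒳 → α) (e : α → 𝒳)
    (h : ∀ x, ν x ≠ 0 → e (d x) = x) : marginal (marginal ν d) e = ν := by
  classical
  funext x
  have := marginal_marginal ν d (fun _ => 1) e x
  simp only [mul_one] at this
  rw [this]
  unfold marginal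
  rw [Finset.sum_eq_single x]
  · by_cases hx : ν x = 0
    · simp [hx]
    · simp [h x hx]
  · intro x' _ hx'
    by_cases hx : ν x' = 0
    · simp [hx]
    · rw [if_neg]
      simpa [h x' hx] using hx'
  · simp

end TwoPhase

/-! ### Cuts of the network in the two phases -/

section Network

universe u v

variable {m : ℕ} {X : Node m → Type u} {Y : Node m → Type v} [∀ i, Fintype (Y i)]

/-- The outputs of the relays in `T`. -/
def relayOut (T : Finset (Fin m)) (y : ∀ i, Option (Y i)) : ∀ j : T, Option (Y (Node.relay j)) :=
  fun j => y (Node.relay j)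

/-- The symbols of the node `t` and of the relays in `T`. -/
def cut {Z : Node m → Type*} (t : Node m) (T : Finset (Fin m)) (z : ∀ i, Option (Z i)) :
    Option (Z t) × (∀ j : T, Option (Z (Node.relay j))) :=
  (z t, fun j => z (Node.relay j))

/-- The channel of phase one. -/
def lawOne (N : HalfDuplexNetwork X Y) (x : X Node.a × X Node.b) : (∀ i, Option (Y i)) → ℝ :=
  N.law (inputOne x.1 x.2)

/-- The channel of phase two. -/
def lawTwo (N : HalfDuplexNetwork X Y) (x : ∀ j : Fin m, X (Node.relay j)) :
    (∀ i, Option (Y i)) → ℝ :=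
  N.law (inputTwo x)

/-- The product of two mass functions. -/
def prodLaw {α β : Type*} (p : α → ℝ) (q : β → ℝ) : α × β → ℝ := fun x => p x.1 * q x.2

lemma HalfDuplexNetwork.law_nonneg (N : HalfDuplexNetwork X Y) (x : ∀ i, Option (X i))
    (y : ∀ i, Option (Y i)) : 0 ≤ N.law x y := (N.law_mem x).1 y

lemma HalfDuplexNetwork.sum_law (N : HalfDuplexNetwork X Y) (x : ∀ i, Option (X i)) :
    ∑ y, N.law x y = 1 := (N.law_mem x).2

variable [∀ i, Fintype (X i)]

/-- Treat `(q, x_a, x_b)` as the input of a channel that ignores `q`; conditioning on `q` then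
averages. -/
lemma infoOneA_jointOne (N : HalfDuplexNetwork X Y) {K : ℕ} {pQ : Fin K → ℝ}
    {pA : Fin K → X Node.a → ℝ} {pB : Fin K → X Node.b → ℝ} (hQ : ∀ q, 0 ≤ pQ q)
    (hA : ∀ q x, 0 ≤ pA q x) (hB : ∀ q x, 0 ≤ pB q x) (T : Finset (Fin m)) :
    infoOneA (jointOne N pQ pA pB) T =
      ∑ q, pQ q * channelInfo (prodLaw (pA q) (pB q)) (lawOne N) (relayOut T) Prod.snd := by
  let e : SpaceOne X Y K ≃ (Fin K × (X Node.a × X Node.b)) × (∀ i, Option (Y i)) :=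
    { toFun := fun ω => ((ω.1, ω.2.1, ω.2.2.1), ω.2.2.2)
      invFun := fun z => (z.1.1, z.1.2.1, z.1.2.2, z.2)
      left_inv := fun _ => rfl
      right_inv := fun _ => rfl }
  rw [← channelInfo_timeSharing, ← condMutualInfo_joint (f := fun z => z.2.1), ← condMutualInfo_equiv e]
  · unfold infoOneA
    congr 1
    funext ω
    simp only [jointOne, joint, prodLaw, lawOne, e, Equiv.coe_fn_mk]
    ring
  · exact fun z => mul_nonneg (hQ _) (mul_nonneg (hA _ _) (hB _ _))
  · exact fun _ _ => N.law_nonneg _ _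
  · exact fun _ => N.sum_law _
  · rintro ⟨q, xa, xb⟩ ⟨q', xa', xb'⟩ h
    simp_all

lemma infoOneB_jointOne (N : HalfDuplexNetwork X Y) {K : ℕ} {pQ : Fin K → ℝ}
    {pA : Fin K → X Node.a → ℝ} {pB : Fin K → X Node.b → ℝ} (hQ : ∀ q, 0 ≤ pQ q)
    (hA : ∀ q x, 0 ≤ pA q x) (hB : ∀ q x, 0 ≤ pB q x) (T : Finset (Fin m)) :
    infoOneB (jointOne N pQ pA pB) T =
      ∑ q, pQ q * channelInfo (prodLaw (pA q) (pB q)) (lawOne N) (relayOut T) Prod.fst := by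
  let e : SpaceOne X Y K ≃ (Fin K × (X Node.a × X Node.b)) × (∀ i, Option (Y i)) :=
    { toFun := fun ω => ((ω.1, ω.2.1, ω.2.2.1), ω.2.2.2)
      invFun := fun z => (z.1.1, z.1.2.1, z.1.2.2, z.2)
      left_inv := fun _ => rfl
      right_inv := fun _ => rfl }
  rw [← channelInfo_timeSharing, ← condMutualInfo_joint (f := fun z => z.2.2), ← condMutualInfo_equiv e]
  · unfold infoOneB
    congr 1
    funext ω
    simp only [jointOne, joint, prodLaw, lawOne, e, Equiv.coe_fn_mk]
    ring
  · exact fun z => mul_nonneg (hQ _) (mul_nonneg (hA _ _) (hB _ _))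
  · exact fun _ _ => N.law_nonneg _ _
  · exact fun _ => N.sum_law _
  · rintro ⟨q, xa, xb⟩ ⟨q', xa', xb'⟩ h
    simp_all

lemma infoTwo_jointTwo (N : HalfDuplexNetwork X Y)
    {pR : (∀ j : Fin m, X (Node.relay j)) → ℝ} (hR : ∀ x, 0 ≤ pR x) (S : Finset (Fin m))
    (t : Node m) :
    infoTwo (jointTwo N pR) S t = channelInfo pR (lawTwo N) (fun y => y t)
      (fun x (j : (Sᶜ : Finset (Fin m))) => x j) := by
  rw [← condMutualInfo_joint (f := fun x (j : S) => x j) hR]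
  · rfl
  · exact fun _ _ => N.law_nonneg _ _
  · exact fun _ => N.sum_law _
  · intro x x' h
    simp only [Prod.mk.injEq] at h
    funext j
    by_cases hj : j ∈ S
    · exact congrFun h.1 ⟨j, hj⟩
    · exact congrFun h.2 ⟨j, Finset.mem_compl.mpr hj⟩

/-- In phase one `b` transmits, so its output is the dummy symbol, and the relays have dummy inputs.
What remains of the cut is `x_b` on the input side and the relay outputs on the output side. -/
lemma channelInfo_cut_b (N : HalfDuplexNetwork X Y) (ν : X Node.a × X Node.b → ℝ)
    (T : Finset (Fin m)) :
    channelInfo (marginal ν fun x => inputOne x.1 x.2) N.law (cut Node.b T) (cut Node.b T) =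
      channelInfo ν (lawOne N) (relayOut T) Prod.snd := by
  rw [channelInfo_pushforward]
  refine channelInfo_congr _ _ _ _ _ _ (fun x x' y y' h h' => ?_) fun x x' => ?_
  · have h1 := (N.half_duplex _ _ h Node.b).resolve_left (by simp [inputOne])
    have h2 := (N.half_duplex _ _ h' Node.b).resolve_left (by simp [inputOne])
    simp only [cut, h1, h2, Prod.mk.injEq, true_and]
    rfl
  · simp [cut, inputOne]

lemma channelInfo_cut_a (N : HalfDuplexNetwork X Y) (ν : X Node.a × X Node.b → ℝ)
    (T : Finset (Fin m)) :
    channelInfo (marginal ν fun x => inputOne x.1 x.2) N.law (cut Node.a T) (cut Node.a T) =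
      channelInfo ν (lawOne N) (relayOut T) Prod.fst := by
  rw [channelInfo_pushforward]
  refine channelInfo_congr _ _ _ _ _ _ (fun x x' y y' h h' => ?_) fun x x' => ?_
  · have h1 := (N.half_duplex _ _ h Node.a).resolve_left (by simp [inputOne])
    have h2 := (N.half_duplex _ _ h' Node.a).resolve_left (by simp [inputOne])
    simp only [cut, h1, h2, Prod.mk.injEq, true_and]
    rfl
  · simp [cut, inputOne]

/-- In phase two the relay outputs and the terminal input are dummies, which leaves the inputs of
the relays outside `S` and the output of `t`. -/
lemma channelInfo_cut_two (N : HalfDuplexNetwork X Y)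
    {pR : (∀ j : Fin m, X (Node.relay j)) → ℝ} (hR : ∀ x, 0 ≤ pR x) (S : Finset (Fin m))
    (t : Node m) (ht : ¬Transmits .two t) :
    channelInfo (marginal pR inputTwo) N.law (cut t Sᶜ) (cut t Sᶜ) =
      infoTwo (jointTwo N pR) S t := by
  rw [channelInfo_pushforward, infoTwo_jointTwo N hR]
  refine channelInfo_congr _ _ _ _ _ _ (fun x x' y y' h h' => ?_) fun x x' => ?_
  · have h1 := fun j => (N.half_duplex _ _ h (Node.relay j)).resolve_left (by simp [inputTwo])
    have h2 := fun j => (N.half_duplex _ _ h' (Node.relay j)).resolve_left (by simp [inputTwo])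
    simp [cut, h1, h2]
  · have : inputTwo x t = inputTwo x' t := by
      cases t <;> simp_all [inputTwo, Transmits]
    simp only [cut, this, Prod.mk.injEq, true_and]
    simp [inputTwo, funext_iff]

end Network

/-! ### Input laws induced by a code, and the finite block length converse -/

section Codes

universe u v

variable {m : ℕ} {X : Node m → Type u} {Y : Node m → Type v} {n Ma Mb : ℕ}

/-- The encoders of a code as a function of the past outputs. -/
def Code.nextInput (c : Code X Y n Ma Mb) (wa : Fin Ma) (wb : Fin Mb) (k : Fin n)
    (p : Fin (k : ℕ) → ∀ i, Option (Y i)) : ∀ i, Option (X i) :=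
  fun i => c.enc i k (messages wa wb i) fun j => p j i

lemma Code.prob_eq [∀ i, Fintype (Y i)] (c : Code X Y n Ma Mb) (N : HalfDuplexNetwork X Y)
    (wa : Fin Ma) (wb : Fin Mb) (y : Fin n → ∀ i, Option (Y i)) :
    c.prob N wa wb y = causalProd (fun k p => N.law (c.nextInput wa wb k p)) y := rfl

lemma Code.nextInput_ne_none (c : Code X Y n Ma Mb) (wa : Fin Ma) (wb : Fin Mb) (k : Fin n)
    (p : Fin (k : ℕ) → ∀ i, Option (Y i)) (i : Node m) :
    c.nextInput wa wb k p i ≠ none ↔ Transmits (phaseAt c.n₁ k) i :=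
  c.enc_protocol i k _ _

/-- The channel uses of phase one. -/
def Code.phaseOne (c : Code X Y n Ma Mb) : Finset (Fin n) :=
  Finset.univ.filter fun k => (k : ℕ) < c.n₁

lemma Code.mem_phaseOne (c : Code X Y n Ma Mb) (k : Fin n) : k ∈ c.phaseOne ↔ (k : ℕ) < c.n₁ := by
  simp [Code.phaseOne]

lemma Code.card_phaseOne (c : Code X Y n Ma Mb) : c.phaseOne.card = c.n₁ := by
  have := Fin.card_filter_val_lt (n := n) (m := c.n₁)
  rw [Code.phaseOne]
  simp [this, c.n₁_le]

variable [∀ i, Fintype (X i)] [∀ i, Fintype (Y i)]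

/-- The receiving side of the cut is `b` with the relays in `T`. Their inputs are functions of `wb`
and of their own past outputs, as the converse requires, even though the code uses feedback. -/
lemma Code.logb_Ma_le (c : Code X Y n Ma Mb) (N : HalfDuplexNetwork X Y) (ha : 0 < Ma)
    (hb : 0 < Mb) (T : Finset (Fin m)) :
    (1 - c.errorAB N) * Real.logb 2 Ma - 2 ≤
      ∑ k ∈ c.phaseOne, channelInfo (inputLaw N.law c.nextInput k) N.law
        (cut Node.b T) (cut Node.b T) +
      channelInfo (fun x => ∑ k ∈ c.phaseOneᶜ, inputLaw N.law c.nextInput k x) N.law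
        (cut Node.b T) (cut Node.b T) := by
  have := Fin.pos_iff_nonempty.mp ha
  have := Fin.pos_iff_nonempty.mp hb
  have := logb_card_le_sum_add N.law_nonneg N.sum_law c.nextInput (cut Node.b T) (cut Node.b T)
    (fun wb k o => (c.enc Node.b k wb fun j => (o j).1,
      fun i => c.enc (Node.relay i) k () fun j => (o j).2 i))
    (fun _ _ _ _ => rfl) c.phaseOne (fun wb o => c.decB wb fun k => (o k).1)
  simp only [Fintype.card_fin] at this
  convert this using 4
  refine congrArg (· / _) (Finset.sum_congr rfl fun _ _ => Finset.sum_congr rfl fun _ _ =>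
    Finset.sum_congr rfl fun _ _ => ?_)
  rw [Code.prob_eq]
  congr

lemma Code.logb_Mb_le (c : Code X Y n Ma Mb) (N : HalfDuplexNetwork X Y) (ha : 0 < Ma)
    (hb : 0 < Mb) (T : Finset (Fin m)) :
    (1 - c.errorBA N) * Real.logb 2 Mb - 2 ≤
      ∑ k ∈ c.phaseOne, channelInfo (inputLaw N.law c.nextInput k) N.law
        (cut Node.a T) (cut Node.a T) +
      channelInfo (fun x => ∑ k ∈ c.phaseOneᶜ, inputLaw N.law c.nextInput k x) N.law
        (cut Node.a T) (cut Node.a T) := by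
  have := Fin.pos_iff_nonempty.mp ha
  have := Fin.pos_iff_nonempty.mp hb
  have := logb_card_le_sum_add N.law_nonneg N.sum_law (fun wb wa => c.nextInput wa wb)
    (cut Node.a T) (cut Node.a T)
    (fun wa k o => (c.enc Node.a k wa fun j => (o j).1,
      fun i => c.enc (Node.relay i) k () fun j => (o j).2 i))
    (fun _ _ _ _ => rfl) c.phaseOne (fun wa o => c.decA wa fun k => (o k).1)
  simp only [Fintype.card_fin, inputLaw_swap] at this
  rw [Finset.sum_comm, mul_comm (Mb : ℝ)] at this
  convert this using 4
  refine congrArg (· / _) (Finset.sum_congr rfl fun _ _ => Finset.sum_congr rfl fun _ _ =>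
    Finset.sum_congr rfl fun _ _ => ?_)
  rw [Code.prob_eq]
  congr

open Classical in
/-- The law of the symbol `f w` for a uniformly distributed message `w`. -/
noncomputable def uniformLaw {α : Type*} (M : ℕ) (f : Fin M → α) (x : α) : ℝ :=
  (∑ w, if f w = x then 1 else 0) / M

lemma uniformLaw_mem {α : Type*} [Fintype α] {M : ℕ} (hM : 0 < M) (f : Fin M → α) :
    uniformLaw M f ∈ stdSimplex ℝ α := by
  classical
  refine ⟨fun x => ?_, ?_⟩
  · exact div_nonneg (Finset.sum_nonneg fun w _ => by split_ifs <;> norm_num) (by positivity)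
  · simp only [uniformLaw]
    rw [← Finset.sum_div, Finset.sum_comm]
    simp [hM.ne']

variable [∀ i, Nonempty (X i)]

/-- The symbol that node `i` sends at time `k` if it has received nothing so far. -/
noncomputable def Code.symbol (c : Code X Y n Ma Mb) (i : Node m) (k : Fin n)
    (w : Message Ma Mb i) : X i :=
  (c.enc i k w fun _ => none).getD (Classical.arbitrary _)

lemma Code.output_eq_none (c : Code X Y n Ma Mb) (N : HalfDuplexNetwork X Y) {wa : Fin Ma}
    {wb : Fin Mb} {y : Fin n → ∀ i, Option (Y i)}
    (h : causalProd (fun k p => N.law (c.nextInput wa wb k p)) y ≠ 0) (k : Fin n) (i : Node m)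
    (hi : Transmits (phaseAt c.n₁ k) i) : y k i = none :=
  (N.half_duplex _ _ ((Finset.prod_ne_zero_iff.mp h) k (Finset.mem_univ k)) i).resolve_left
    ((c.nextInput_ne_none wa wb k _ i).mpr hi)

/-- Both terminals have transmitted at every earlier time, hence have received only dummies: their
past outputs carry no information and the encoders see the message alone. -/
lemma Code.nextInput_phaseOne (c : Code X Y n Ma Mb) (N : HalfDuplexNetwork X Y) {wa : Fin Ma}
    {wb : Fin Mb} {y : Fin n → ∀ i, Option (Y i)}
    (h : causalProd (fun k p => N.law (c.nextInput wa wb k p)) y ≠ 0) {k : Fin n}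
    (hk : k ∈ c.phaseOne) : c.nextInput wa wb k (past y k) =
      inputOne (c.symbol Node.a k wa) (c.symbol Node.b k wb) := by
  have hk1 := (c.mem_phaseOne k).mp hk
  have hph : phaseAt c.n₁ k = .one := if_pos hk1
  have hp : ∀ (i : Node m), Transmits .one i → (fun j => past y k j i) = fun _ => none := by
    intro i hi
    funext j
    refine c.output_eq_none N h _ i ?_
    rwa [show phaseAt c.n₁ _ = .one from if_pos (j.isLt.trans hk1)]
  funext i
  have hne := c.nextInput_ne_none wa wb k (past y k) i
  rw [hph] at hne
  cases i with
  | a =>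
    have h1 := hne.mpr trivial
    simp only [Code.nextInput, messages, hp Node.a trivial] at h1 ⊢
    obtain ⟨x, hx⟩ := Option.ne_none_iff_exists'.mp h1
    simp [inputOne, Code.symbol, hx]
  | b =>
    have h1 := hne.mpr trivial
    simp only [Code.nextInput, messages, hp Node.b trivial] at h1 ⊢
    obtain ⟨x, hx⟩ := Option.ne_none_iff_exists'.mp h1
    simp [inputOne, Code.symbol, hx]
  | relay j =>
    have : ¬ c.nextInput wa wb k (past y k) (Node.relay j) ≠ none := fun h' => hne.mp h'
    simpa [inputOne] using this

/-- The transmitted symbols of the terminals. -/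
noncomputable def terminalSymbols (x : ∀ i, Option (X i)) : X Node.a × X Node.b :=
  ((x Node.a).getD (Classical.arbitrary _), (x Node.b).getD (Classical.arbitrary _))

/-- The transmitted symbols of the relays. -/
noncomputable def relaySymbols (x : ∀ i, Option (X i)) : ∀ j : Fin m, X (Node.relay j) :=
  fun j => (x (Node.relay j)).getD (Classical.arbitrary _)

/-- Each terminal symbol is a function of that terminal's own message, and the messages are
independent and uniform. -/
lemma Code.inputLaw_phaseOne (c : Code X Y n Ma Mb) (N : HalfDuplexNetwork X Y) {k : Fin n}
    (hk : k ∈ c.phaseOne) : inputLaw N.law c.nextInput k =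
      marginal (prodLaw (uniformLaw Ma (c.symbol Node.a k)) (uniformLaw Mb (c.symbol Node.b k)))
        fun x => inputOne x.1 x.2 := by
  classical
  rw [← marginal_marginal_of_leftInv (inputLaw N.law c.nextInput k) terminalSymbols
    fun x => inputOne x.1 x.2]
  · congr 1
    funext x
    have h1 : marginal (inputLaw N.law c.nextInput k) terminalSymbols x =
        ∑ z, inputLaw N.law c.nextInput k z * if terminalSymbols z = x then 1 else 0 := by
      refine Finset.sum_congr rfl fun z _ => ?_
      by_cases h : terminalSymbols z = x <;> simp [h]
    rw [h1, sum_inputLaw_mul]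
    -- On outputs of positive probability the indicator does not depend on `y`, so the output law
    -- sums out to 1.
    have h2 : ∀ wa wb, ∑ y, causalProd (fun k p => N.law (c.nextInput wa wb k p)) y *
        (if terminalSymbols (c.nextInput wa wb k (past y k)) = x then (1 : ℝ) else 0) =
        (if c.symbol Node.a k wa = x.1 then 1 else 0) *
          if c.symbol Node.b k wb = x.2 then 1 else 0 := by
      intro wa wb
      have : ∀ y, causalProd (fun k p => N.law (c.nextInput wa wb k p)) y *
        (if terminalSymbols (c.nextInput wa wb k (past y k)) = x then (1 : ℝ) else 0) =
          causalProd (fun k p => N.law (c.nextInput wa wb k p)) y *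
          ((if c.symbol Node.a k wa = x.1 then 1 else 0) *
          if c.symbol Node.b k wb = x.2 then 1 else 0) := by
        intro y
        by_cases h : causalProd (fun k p => N.law (c.nextInput wa wb k p)) y = 0
        · simp [h]
        · rw [c.nextInput_phaseOne N h hk, ite_zero_mul_ite_zero]
          simp [terminalSymbols, inputOne, Prod.ext_iff]
      simp_rw [this]
      rw [← Finset.sum_mul, sum_causalProd _ fun _ _ => N.sum_law _, one_mul]
    simp_rw [h2]
    simp only [prodLaw, uniformLaw, Fintype.card_fin, div_mul_div_comm, Finset.sum_mul_sum]
  · intro x hx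
    obtain ⟨wa, wb, y, rfl, hy⟩ := exists_of_inputLaw_ne_zero hx
    rw [c.nextInput_phaseOne N hy hk]
    simp [terminalSymbols, inputOne]

lemma Code.inputTwo_relaySymbols (c : Code X Y n Ma Mb) (N : HalfDuplexNetwork X Y) {k : Fin n}
    (hk : k ∉ c.phaseOne) {x : ∀ i, Option (X i)} (hx : inputLaw N.law c.nextInput k x ≠ 0) :
    inputTwo (relaySymbols x) = x := by
  obtain ⟨wa, wb, y, rfl, -⟩ := exists_of_inputLaw_ne_zero hx
  have hph : phaseAt c.n₁ k = .two := if_neg fun h => hk ((c.mem_phaseOne k).mpr h)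
  funext i
  have hne := c.nextInput_ne_none wa wb k (past y k) i
  rw [hph] at hne
  cases i with
  | a => simpa [inputTwo, Transmits, eq_comm] using hne
  | b => simpa [inputTwo, Transmits, eq_comm] using hne
  | relay j =>
    obtain ⟨x, hx⟩ := Option.ne_none_iff_exists'.mp (hne.mpr trivial)
    simp [inputTwo, relaySymbols, hx]

/-- The total input law of phase two comes from a single law of the relay inputs. -/
lemma Code.exists_relayLaw (c : Code X Y n Ma Mb) (N : HalfDuplexNetwork X Y) (ha : 0 < Ma)
    (hb : 0 < Mb) : ∃ pR ∈ stdSimplex ℝ (∀ j : Fin m, X (Node.relay j)),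
      (fun x => ∑ k ∈ c.phaseOneᶜ, inputLaw N.law c.nextInput k x) =
        fun x => ((n : ℝ) - c.n₁) * marginal pR inputTwo x := by
  classical
  have := Fin.pos_iff_nonempty.mp ha
  have := Fin.pos_iff_nonempty.mp hb
  have hcard : ((c.phaseOneᶜ.card : ℕ) : ℝ) = (n : ℝ) - c.n₁ := by
    rw [Finset.card_compl, c.card_phaseOne, Fintype.card_fin, Nat.cast_sub c.n₁_le]
  have h0 := inputLaw_nonneg N.law_nonneg c.nextInput
  set ν : (∀ i, Option (X i)) → ℝ := fun x => ∑ k ∈ c.phaseOneᶜ, inputLaw N.law c.nextInput k x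
    with hν
  have hν0 : ∀ x, 0 ≤ ν x := fun x => Finset.sum_nonneg fun k _ => h0 k x
  have hsum : ∑ x, ν x = (n : ℝ) - c.n₁ := by
    rw [← hcard, hν, Finset.sum_comm]
    simp [sum_inputLaw N.sum_law]
  rcases eq_or_ne ((n : ℝ) - c.n₁) 0 with hn | hn
  -- An empty phase two has zero total law, so any relay law will do.
  · refine ⟨Pi.single (Classical.arbitrary _) 1, single_mem_stdSimplex ℝ _, ?_⟩
    funext x
    rw [hn] at hsum
    rw [hn, zero_mul]
    exact (Finset.sum_eq_zero_iff_of_nonneg fun x _ => hν0 x).mp hsum x (Finset.mem_univ x)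
  · have hn0 : 0 ≤ (n : ℝ) - c.n₁ := hcard ▸ Nat.cast_nonneg _
    refine ⟨fun x => ((n : ℝ) - c.n₁)⁻¹ * marginal ν relaySymbols x, ⟨fun x => ?_, ?_⟩, ?_⟩
    · exact mul_nonneg (inv_nonneg.mpr hn0) (marginal_nonneg hν0 _ _)
    · rw [← Finset.mul_sum, sum_marginal, hsum, inv_mul_cancel₀ hn]
    · funext x
      rw [marginal_smul, mul_inv_cancel_left₀ hn, marginal_marginal_of_leftInv]
      intro x hx
      obtain ⟨k, hk, hk'⟩ := Finset.exists_ne_zero_of_sum_ne_zero hx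
      exact c.inputTwo_relaySymbols N (Finset.mem_compl.mp hk) hk'

/-- The finite block length converse of the MABC protocol. -/
lemma Code.exists_bounds (c : Code X Y n Ma Mb) (N : HalfDuplexNetwork X Y) (ha : 0 < Ma)
    (hb : 0 < Mb) :
    ∃ (pA : Fin n → X Node.a → ℝ) (pB : Fin n → X Node.b → ℝ)
      (pR : (∀ j : Fin m, X (Node.relay j)) → ℝ),
      (∀ k, pA k ∈ stdSimplex ℝ (X Node.a)) ∧ (∀ k, pB k ∈ stdSimplex ℝ (X Node.b)) ∧
      pR ∈ stdSimplex ℝ (∀ j : Fin m, X (Node.relay j)) ∧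
      ∀ S : Finset (Fin m),
        (1 - c.errorAB N) * Real.logb 2 Ma - 2 ≤
          ∑ k ∈ c.phaseOne,
            channelInfo (prodLaw (pA k) (pB k)) (lawOne N) (relayOut Sᶜ) Prod.snd +
          ((n : ℝ) - c.n₁) * infoTwo (jointTwo N pR) S Node.b ∧
        (1 - c.errorBA N) * Real.logb 2 Mb - 2 ≤
          ∑ k ∈ c.phaseOne,
            channelInfo (prodLaw (pA k) (pB k)) (lawOne N) (relayOut Sᶜ) Prod.fst +
          ((n : ℝ) - c.n₁) * infoTwo (jointTwo N pR) S Node.a := by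
  -- All three laws are fixed before `S` and the direction, which makes the constraints
  -- simultaneous.
  obtain ⟨pR, hR, hνR⟩ := c.exists_relayLaw N ha hb
  refine ⟨fun k => uniformLaw Ma (c.symbol Node.a k), fun k => uniformLaw Mb (c.symbol Node.b k),
    pR, fun k => uniformLaw_mem ha _, fun k => uniformLaw_mem hb _, hR, fun S => ⟨?_, ?_⟩⟩
  · refine (c.logb_Ma_le N ha hb Sᶜ).trans_eq ?_
    rw [hνR, channelInfo_smul, channelInfo_cut_two N hR.1 S Node.b id]
    congr 1
    refine Finset.sum_congr rfl fun k hk => ?_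
    rw [c.inputLaw_phaseOne N hk, channelInfo_cut_b]
  · refine (c.logb_Mb_le N ha hb Sᶜ).trans_eq ?_
    rw [hνR, channelInfo_smul, channelInfo_cut_two N hR.1 S Node.a id]
    congr 1
    refine Finset.sum_congr rfl fun k hk => ?_
    rw [c.inputLaw_phaseOne N hk, channelInfo_cut_a]

end Codes

/-- Carathéodory's theorem for averages of a family of real vectors, with a prescribed number of
points. -/
lemma exists_sum_mul_eq_average {P ι κ : Type*} [Nonempty P] [Fintype ι] {K : ℕ}
    (hK : Fintype.card ι + 1 ≤ K) (F : P → ι → ℝ) (s : Finset κ) (hs : s.Nonempty) (z : κ → P) :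
    ∃ (w : Fin K → ℝ) (x : Fin K → P), w ∈ stdSimplex ℝ (Fin K) ∧
      ∀ i, (s.card : ℝ) * ∑ q, w q * F (x q) i = ∑ k ∈ s, F (z k) i := by
  classical
  have hc : (s.card : ℝ) ≠ 0 := by exact_mod_cast hs.card_pos.ne'
  have hmem : ∑ k ∈ s, (s.card : ℝ)⁻¹ • F (z k) ∈ convexHull ℝ (Set.range F) := by
    refine (convex_convexHull ℝ _).sum_mem (fun _ _ => by positivity) ?_ fun k _ =>
      subset_convexHull ℝ _ ⟨_, rfl⟩
    simp [hc]
  obtain ⟨τ, hτ, v, w, hv, hind, hw0, hw1, hsum⟩ := eq_pos_convex_span_of_mem_convexHull hmem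
  -- Affinely independent points of a space of dimension `card ι` number at most `card ι + 1`.
  have hcard : Fintype.card τ ≤ Fintype.card (Fin K) := by
    refine hind.card_le_finrank_succ.trans (le_trans ?_ (hK.trans_eq (Fintype.card_fin K).symm))
    have := Submodule.finrank_le (vectorSpan ℝ (Set.range v))
    rw [Module.finrank_fintype_fun_eq_card] at this
    omega
  obtain ⟨e⟩ := Function.Embedding.nonempty_of_card_le hcard
  choose x hx using fun t => hv (Set.mem_range_self t)
  have hext : ∀ G : τ → ℝ, ∑ q, Function.extend e G 0 q = ∑ t, G t := fun G => by
    rw [← Finset.sum_subset (Finset.subset_univ (Finset.univ.map e)), Finset.sum_map]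
    · simp [e.injective.extend_apply]
    · intro q _ hq
      rw [Function.extend_apply' _ _ _ (by simpa using hq)]
      rfl
  -- The unused indices get weight 0 and an arbitrary point.
  refine ⟨Function.extend e w 0, Function.extend e x fun _ => Classical.arbitrary P,
    ⟨fun q => ?_, (hext w).trans hw1⟩, fun i => ?_⟩
  · by_cases hq : ∃ t, e t = q
    · obtain ⟨t, rfl⟩ := hq
      rw [e.injective.extend_apply]
      exact (hw0 t).le
    · rw [Function.extend_apply' _ _ _ hq]
      rfl
  · have h1 : ∀ q, Function.extend e w 0 q *
        F (Function.extend e x (fun _ => Classical.arbitrary P) q) i =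
        Function.extend e (fun t => w t * v t i) 0 q := fun q => by
      by_cases hq : ∃ t, e t = q
      · obtain ⟨t, rfl⟩ := hq
        simp only [e.injective.extend_apply, hx]
      · simp only [Function.extend_apply' _ _ _ hq, Pi.zero_apply, zero_mul]
    simp_rw [h1]
    rw [hext]
    have h2 := congrFun hsum i
    simp only [Finset.sum_apply, Pi.smul_apply, smul_eq_mul] at h2
    rw [h2, ← Finset.mul_sum, mul_inv_cancel_left₀ hc]

/-! ### Time sharing, compactness and the limit of large block length -/

section Bound

universe u v

variable {m : ℕ} {X : Node m → Type u} {Y : Node m → Type v} [∀ i, Fintype (X i)]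
  [∀ i, Fintype (Y i)]

/-- The choices of `p(q)`, `p(x_a|q)`, `p(x_b|q)` and `p(x_R)` for `2 ^ (m + 1)` values of `q`. -/
def paramSet (X : Node m → Type u) [∀ i, Fintype (X i)] :
    Set ((Fin (2 ^ (m + 1)) → ℝ) × (Fin (2 ^ (m + 1)) → X Node.a → ℝ) ×
      (Fin (2 ^ (m + 1)) → X Node.b → ℝ) × ((∀ j : Fin m, X (Node.relay j)) → ℝ)) :=
  stdSimplex ℝ _ ×ˢ (Set.univ.pi fun _ => stdSimplex ℝ _) ×ˢ
    (Set.univ.pi fun _ => stdSimplex ℝ _) ×ˢ stdSimplex ℝ _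

lemma isCompact_paramSet : IsCompact (paramSet X) :=
  (isCompact_stdSimplex ℝ _).prod ((isCompact_univ_pi fun _ => isCompact_stdSimplex ℝ _).prod
    ((isCompact_univ_pi fun _ => isCompact_stdSimplex ℝ _).prod (isCompact_stdSimplex ℝ _)))

/-- The tuples `((Δ₁, Δ₂), (R_a, R_b))` that satisfy the rate constraints for some choice of
distributions. -/
def boundSet (N : HalfDuplexNetwork X Y) : Set ((ℝ × ℝ) × (ℝ × ℝ)) :=
  {r | ∃ p ∈ paramSet X, ∀ S : Finset (Fin m),
    r.2.1 ≤ r.1.1 * infoOneA (jointOne N p.1 p.2.1 p.2.2.1) Sᶜ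
      + r.1.2 * infoTwo (jointTwo N p.2.2.2) S Node.b ∧
    r.2.2 ≤ r.1.1 * infoOneB (jointOne N p.1 p.2.1 p.2.2.1) Sᶜ
      + r.1.2 * infoTwo (jointTwo N p.2.2.2) S Node.a}

/-- It is the projection of a closed set along a compact factor. The phase durations are coordinates
too, because those of the codes only converge to `(Δ₁, Δ₂)`. -/
lemma isClosed_boundSet (N : HalfDuplexNetwork X Y) : IsClosed (boundSet N) := by
  have h1 : Continuous fun z : ((ℝ × ℝ) × (ℝ × ℝ)) × (paramSet X) =>
      jointOne N z.2.1.1 z.2.1.2.1 z.2.1.2.2.1 := by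
    unfold jointOne
    fun_prop
  have h2 : Continuous fun z : ((ℝ × ℝ) × (ℝ × ℝ)) × (paramSet X) =>
      jointTwo N z.2.1.2.2.2 := by
    unfold jointTwo
    fun_prop
  have hA : ∀ T, Continuous fun z : ((ℝ × ℝ) × (ℝ × ℝ)) × (paramSet X) =>
      infoOneA (jointOne N z.2.1.1 z.2.1.2.1 z.2.1.2.2.1) T := fun T =>
    (continuous_condMutualInfo _ _ _).comp h1
  have hB : ∀ T, Continuous fun z : ((ℝ × ℝ) × (ℝ × ℝ)) × (paramSet X) =>
      infoOneB (jointOne N z.2.1.1 z.2.1.2.1 z.2.1.2.2.1) T := fun T =>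
    (continuous_condMutualInfo _ _ _).comp h1
  have hT : ∀ S t, Continuous fun z : ((ℝ × ℝ) × (ℝ × ℝ)) × (paramSet X) =>
      infoTwo (jointTwo N z.2.1.2.2.2) S t := fun S t =>
    (continuous_condMutualInfo _ _ _).comp h2
  have hcl : IsClosed {z : ((ℝ × ℝ) × (ℝ × ℝ)) × (paramSet X) | ∀ S : Finset (Fin m),
      z.1.2.1 ≤ z.1.1.1 * infoOneA (jointOne N z.2.1.1 z.2.1.2.1 z.2.1.2.2.1) Sᶜ
        + z.1.1.2 * infoTwo (jointTwo N z.2.1.2.2.2) S Node.b ∧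
      z.1.2.2 ≤ z.1.1.1 * infoOneB (jointOne N z.2.1.1 z.2.1.2.1 z.2.1.2.2.1) Sᶜ
        + z.1.1.2 * infoTwo (jointTwo N z.2.1.2.2.2) S Node.a} := by
    simp only [Set.ofPred_forall, Set.ofPred_and]
    refine isClosed_iInter fun S => IsClosed.inter ?_ ?_
    · have := hA Sᶜ; have := hT S Node.b
      exact isClosed_le (by fun_prop) (by fun_prop)
    · have := hB Sᶜ; have := hT S Node.a
      exact isClosed_le (by fun_prop) (by fun_prop)
  have : CompactSpace (paramSet X) := isCompact_iff_compactSpace.mp isCompact_paramSet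
  convert isClosedMap_fst_of_compactSpace _ hcl using 1
  ext r
  simp [boundSet]

lemma mem_outerBound_of_mem_boundSet {N : HalfDuplexNetwork X Y} {Δ₁ Δ₂ : ℝ} {R : ℝ × ℝ}
    (h1 : 0 ≤ R.1) (h2 : 0 ≤ R.2) (h : ((Δ₁, Δ₂), R) ∈ boundSet N) : R ∈ outerBound N Δ₁ Δ₂ := by
  obtain ⟨⟨pQ, pA, pB, pR⟩, ⟨hQ, hA, hB, hR⟩, hb⟩ := h
  exact ⟨h1, h2, _, le_rfl, pQ, pA, pB, pR, hQ, fun q => hA q trivial, fun q => hB q trivial, hR, hb⟩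

variable [∀ i, Nonempty (X i)]

/-- The uniform time index on `s` is a time-sharing variable already; Carathéodory shrinks its
alphabet while keeping every information value. -/
lemma exists_timeSharing (N : HalfDuplexNetwork X Y) {κ : Type*} (s : Finset κ)
    {pA : κ → X Node.a → ℝ} {pB : κ → X Node.b → ℝ} (hA : ∀ k, pA k ∈ stdSimplex ℝ (X Node.a))
    (hB : ∀ k, pB k ∈ stdSimplex ℝ (X Node.b)) :
    ∃ (pQ : Fin (2 ^ (m + 1)) → ℝ) (pA' : Fin (2 ^ (m + 1)) → X Node.a → ℝ)
      (pB' : Fin (2 ^ (m + 1)) → X Node.b → ℝ),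
      pQ ∈ stdSimplex ℝ _ ∧ (∀ q, pA' q ∈ stdSimplex ℝ _) ∧ (∀ q, pB' q ∈ stdSimplex ℝ _) ∧
      ∀ T : Finset (Fin m),
        (s.card : ℝ) * infoOneA (jointOne N pQ pA' pB') T =
          ∑ k ∈ s, channelInfo (prodLaw (pA k) (pB k)) (lawOne N) (relayOut T) Prod.snd ∧
        (s.card : ℝ) * infoOneB (jointOne N pQ pA' pB') T =
          ∑ k ∈ s, channelInfo (prodLaw (pA k) (pB k)) (lawOne N) (relayOut T) Prod.fst := by
  classical
  have : Nonempty (stdSimplex ℝ (X Node.a)) :=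
    ⟨⟨_, single_mem_stdSimplex ℝ (Classical.arbitrary _)⟩⟩
  have : Nonempty (stdSimplex ℝ (X Node.b)) :=
    ⟨⟨_, single_mem_stdSimplex ℝ (Classical.arbitrary _)⟩⟩
  rcases s.eq_empty_or_nonempty with rfl | hs
  · refine ⟨Pi.single ⟨0, by positivity⟩ 1, fun _ => (Classical.arbitrary (stdSimplex ℝ (X Node.a))).1,
      fun _ => (Classical.arbitrary (stdSimplex ℝ (X Node.b))).1, single_mem_stdSimplex ℝ _,
      fun _ => Subtype.property _, fun _ => Subtype.property _, fun T => by simp⟩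
  -- The empty set carries no information and is left out. That leaves `2 * (2 ^ m - 1)`
  -- coordinates, so `2 ^ (m + 1) - 1` points suffice; with it, the count would exceed `2 ^ (m +
  -- 1)`. The sum type gives both directions a common conditioning alphabet.
  let F : stdSimplex ℝ (X Node.a) × stdSimplex ℝ (X Node.b) →
      {T : Finset (Fin m) // T ≠ ∅} × Bool → ℝ := fun p i =>
    channelInfo (prodLaw p.1.1 p.2.1) (lawOne N) (relayOut i.1.1)
      (fun x => if i.2 then Sum.inl x.1 else Sum.inr x.2)
  have hK : Fintype.card ({T : Finset (Fin m) // T ≠ ∅} × Bool) + 1 ≤ 2 ^ (m + 1) := by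
    have h1 : 1 ≤ 2 ^ m := Nat.one_le_two_pow
    rw [Fintype.card_prod, Fintype.card_bool, Fintype.card_subtype_compl, Fintype.card_finset,
      Fintype.card_fin, Fintype.card_subtype_eq, pow_succ]
    omega
  obtain ⟨w, x, hw, hx⟩ := exists_sum_mul_eq_average hK F s hs fun k => (⟨pA k, hA k⟩, ⟨pB k, hB k⟩)
  refine ⟨w, fun q => (x q).1.1, fun q => (x q).2.1, hw, fun q => (x q).1.2, fun q => (x q).2.2,
    fun T => ?_⟩
  have hA0 : ∀ q y, 0 ≤ (x q).1.1 y := fun q => (x q).1.2.1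
  have hB0 : ∀ q y, 0 ≤ (x q).2.1 y := fun q => (x q).2.2.1
  rw [infoOneA_jointOne N hw.1 hA0 hB0, infoOneB_jointOne N hw.1 hA0 hB0]
  rcases eq_or_ne T ∅ with rfl | hT
  · have hz : ∀ {G : Type u} (p : X Node.a → ℝ) (q : X Node.b → ℝ) (g : X Node.a × X Node.b → G),
        (∀ y, 0 ≤ p y) → (∀ y, 0 ≤ q y) →
        channelInfo (prodLaw p q) (lawOne N) (relayOut ∅) g = 0 := fun p q g hp hq =>
      channelInfo_of_subsingleton (fun x => mul_nonneg (hp _) (hq _)) (fun _ => N.sum_law _) _ _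
    simp [hz _ _ _ (hA0 _) (hB0 _), hz _ _ _ (hA _).1 (hB _).1]
  · have hF : ∀ p : stdSimplex ℝ (X Node.a) × stdSimplex ℝ (X Node.b),
        channelInfo (prodLaw p.1.1 p.2.1) (lawOne N) (relayOut T) Prod.snd =
          F p (⟨T, hT⟩, false) ∧
        channelInfo (prodLaw p.1.1 p.2.1) (lawOne N) (relayOut T) Prod.fst =
          F p (⟨T, hT⟩, true) := fun p =>
      ⟨channelInfo_congr _ _ _ _ _ _ (fun _ _ _ _ _ _ => Iff.rfl) (by simp),
        channelInfo_congr _ _ _ _ _ _ (fun _ _ _ _ _ _ => Iff.rfl) (by simp)⟩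
    have e1 := hx (⟨T, hT⟩, false)
    have e2 := hx (⟨T, hT⟩, true)
    simp only [← (hF _).1] at e1
    simp only [← (hF _).2] at e2
    exact ⟨e1, e2⟩

lemma Code.mem_boundSet {n Ma Mb : ℕ} (c : Code X Y n Ma Mb) (N : HalfDuplexNetwork X Y)
    (hn : 0 < n) (ha : 0 < Ma) (hb : 0 < Mb) :
    (((c.n₁ : ℝ) / n, ((n : ℝ) - c.n₁) / n),
      (((1 - c.errorAB N) * Real.logb 2 Ma - 2) / n,
        ((1 - c.errorBA N) * Real.logb 2 Mb - 2) / n)) ∈ boundSet N := by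
  obtain ⟨pA, pB, pR, hA, hB, hR, hS⟩ := c.exists_bounds N ha hb
  obtain ⟨pQ, pA', pB', hQ, hA', hB', hT⟩ := exists_timeSharing N c.phaseOne hA hB
  refine ⟨(pQ, pA', pB', pR), ⟨hQ, fun q _ => hA' q, fun q _ => hB' q, hR⟩, fun S => ?_⟩
  have hn' : (0 : ℝ) < n := by exact_mod_cast hn
  obtain ⟨h1, h2⟩ := hS S
  rw [← (hT Sᶜ).1, c.card_phaseOne] at h1
  rw [← (hT Sᶜ).2, c.card_phaseOne] at h2
  simp only [div_mul_eq_mul_div, ← add_div]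
  exact ⟨div_le_div_of_nonneg_right h1 hn'.le, div_le_div_of_nonneg_right h2 hn'.le⟩

lemma numMessages_pos (n : ℕ) {R : ℝ} (hR : 0 ≤ R) : 0 < numMessages n R :=
  Nat.floor_pos.mpr (Real.one_le_rpow one_le_two (by positivity))

/-- Rounding down a number that is at least 1 loses less than a factor 2, that is, one bit. -/
lemma le_logb_numMessages (n : ℕ) {R : ℝ} (hR : 0 ≤ R) :
    n * R - 1 ≤ Real.logb 2 (numMessages n R) := by
  have h1 : (1 : ℝ) ≤ 2 ^ ((n : ℝ) * R) := Real.one_le_rpow one_le_two (by positivity)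
  have h2 := Nat.lt_floor_add_one ((2 : ℝ) ^ ((n : ℝ) * R))
  have h3 : (1 : ℝ) ≤ numMessages n R := by exact_mod_cast numMessages_pos n hR
  rw [Real.le_logb_iff_rpow_le one_lt_two (by linarith), Real.rpow_sub two_pos, Real.rpow_one]
  unfold numMessages at h3 ⊢
  linarith

/-- Vanishing errors make the normalized bound on the number of messages tend to the rate. -/
lemma tendsto_rate {R : ℝ} {ε : ℕ → ℝ} (hε : Tendsto ε atTop (𝓝 0)) :
    Tendsto (fun n : ℕ => (1 - ε n) * (R - 1 / n) - 2 / n) atTop (𝓝 R) := by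
  have h1 : Tendsto (fun n : ℕ => (1 : ℝ) / n) atTop (𝓝 0) := tendsto_const_div_atTop_nhds_zero_nat 1
  have h2 : Tendsto (fun n : ℕ => (2 : ℝ) / n) atTop (𝓝 0) := tendsto_const_div_atTop_nhds_zero_nat 2
  simpa using ((tendsto_const_nhds (x := (1 : ℝ))).sub hε).mul
    ((tendsto_const_nhds (x := R)).sub h1) |>.sub h2

lemma rate_le {n : ℕ} (hn : 0 < n) {R ε : ℝ} (hR : 0 ≤ R) (hε : ε ≤ 1) :
    (1 - ε) * (R - 1 / n) - 2 / n ≤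
      ((1 - ε) * Real.logb 2 (numMessages n R) - 2) / n := by
  have hn' : (0 : ℝ) < n := by exact_mod_cast hn
  rw [le_div_iff₀ hn']
  have := mul_le_mul_of_nonneg_left (le_logb_numMessages n hR) (sub_nonneg.mpr hε)
  have e : ((1 - ε) * (R - 1 / n) - 2 / n) * n = (1 - ε) * (n * R - 1) - 2 := by
    field_simp
  linarith

/-- The codes give points of a closed set that converge to the claimed one. -/
lemma Achievable.mem_boundSet {N : HalfDuplexNetwork X Y} {Δ₁ Δ₂ : ℝ} {R : ℝ × ℝ}
    (h : Achievable N Δ₁ Δ₂ R) : ((Δ₁, Δ₂), R) ∈ boundSet N := by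
  obtain ⟨h1, h2, c, hab, hba, hn1, hn2⟩ := h
  refine (isClosed_boundSet N).mem_of_tendsto ((hn1.prodMk_nhds hn2).prodMk_nhds
    ((tendsto_rate (R := R.1) hab).prodMk_nhds (tendsto_rate (R := R.2) hba))) ?_
  -- Error at most 1 keeps the factor `1 - ε` nonnegative when the message count is replaced by its
  -- lower bound.
  filter_upwards [eventually_gt_atTop 0, hab.eventually_le_const one_pos,
    hba.eventually_le_const one_pos] with n hn hεa hεb
  obtain ⟨p, hp, hS⟩ := (c n).mem_boundSet N hn (numMessages_pos n h1) (numMessages_pos n h2)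
  exact ⟨p, hp, fun S => ⟨(rate_le hn h1 hεa).trans (hS S).1, (rate_le hn h2 hεb).trans (hS S).2⟩⟩

end Bound

end MABC

theorem mainTheorem6 {m : ℕ} {X : MABC.Node m → Type*} {Y : MABC.Node m → Type*}
    [∀ i, Fintype (X i)] [∀ i, Nonempty (X i)] [∀ i, Fintype (Y i)]
    (N : MABC.HalfDuplexNetwork X Y) (Δ₁ Δ₂ : ℝ) (hΔ₁ : 0 ≤ Δ₁) (hΔ₂ : 0 ≤ Δ₂)
    (hΔ : Δ₁ + Δ₂ = 1) :
    MABC.capacityRegion N Δ₁ Δ₂ ⊆ MABC.outerBound N Δ₁ Δ₂ := by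
  intro R hR
  -- The slice of `boundSet` at the fixed durations is closed, so it contains the closure of the
  -- achievable pairs.
  have hcl : IsClosed {R : ℝ × ℝ | 0 ≤ R.1 ∧ 0 ≤ R.2 ∧ ((Δ₁, Δ₂), R) ∈ MABC.boundSet N} :=
    (isClosed_le continuous_const continuous_fst).inter
      ((isClosed_le continuous_const continuous_snd).inter
        ((MABC.isClosed_boundSet N).preimage (by fun_prop)))
  have hsub : {R | MABC.Achievable N Δ₁ Δ₂ R} ⊆
      {R : ℝ × ℝ | 0 ≤ R.1 ∧ 0 ≤ R.2 ∧ ((Δ₁, Δ₂), R) ∈ MABC.boundSet N} :=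
    fun R h => ⟨h.1, h.2.1, h.mem_boundSet⟩
  obtain ⟨h1, h2, h⟩ := closure_minimal hsub hcl hR
  exact MABC.mem_outerBound_of_mem_boundSet h1 h2 h
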